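/- Let $M$ be a lattice (a free abelian group of finite rank), let $\Gamma\subseteq M$ be a pointed affine semigroup generating $M$ (a finitely generated submonoid whose only invertible element is $0$ and which generates $M$ as a group), and let $K$ be a field. Put $M_\mathbb{R}=M\otimes\mathbb{R}$, $N=\mathrm{Hom}(M,\mathbb{Z})$ and $N_\mathbb{R}=\mathrm{Hom}_{\mathbb R}(M_\mathbb{R},\mathbb{R})$. Let $\check\sigma\subseteq M_\mathbb{R}$ be the convex cone generated by $\Gamma$ and let $\sigma\subseteq N_\mathbb{R}$ be its dual cone. Let $L=L(\sigma,N)$ be the set of semigroup morphisms $\omega\colon(\check\sigma\cap M,+)\to(\mathbb{R}\cup\{+\infty\},+)$ with $\omega(0)=0$, with the topology of pointwise convergence. Let $\overline\sigma\subseteq L$ be the subset of those morphisms with values in $[0,+\infty]$, and let $\overline\sigma^\circ\subseteq\overline\sigma$ be the subset of those which are moreover positive on all non-invertible (that is, nonzero) elements of $\check\sigma\cap M$. For each face $\tau$ of $\sigma$ (including $\{0\}$ and $\sigma$), let $N_\tau$ be the sublattice of $N$ spanned by $\tau\cap N$; the space $(N/N_\tau)_\mathbb{R}$, the quotient of $N_\mathbb{R}$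 by the linear span of $\tau$, is embedded in $L$: its element $w$ corresponds to the morphism equal to $w$ on $\tau^\perp\cap\check\sigma\cap M$ and to $+\infty$ on the rest of $\check\sigma\cap M$. A valuation of a commutative ring $R$ is a map $v\colon R\to\mathbb{R}\cup\{+\infty\}$ with $v(0)=+\infty$, $v(1)=0$, $v(gh)=v(g)+v(h)$ and $v(g+h)\ge\min\{v(g),v(h)\}$. Let $K[[\Gamma]]$ be the ring of formal power series $\sum_{m\in\Gamma}a_m\chi^m$ with coefficients $a_m\in K$. For a non-invertible $f\in K[[\Gamma]]$, let $R=K[[\Gamma]]/(f)$, a local ring, and let $\gamma\colon\Gamma\to R$ be the natural semigroup morphism $m\mapsto\chi^m$. For a valuation $v$ of $R$, the morphism $v\circ\gamma$ extends uniquely from $\Gamma$ to $\check\sigma\cap M$, hence defines a point $\Phi_\gamma(v)\in L$. The nonnegative tropicalization $\mathrm{Trop}_{\ge0}(f)$ is the set of all $\Phi_\gamma(v)$, where $v$ is a valuation of $R$ with $v\ge0$ on $R$. The positive tropicalization $\mathrm{Trop}_{>0}(f)$ is the closure in $\overline\sigma^\circ$ of the set of all $\Phi_\gamma(v)$, where $v$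 is a valuation with $v\ge 0$ on $R$ such that $\{g\in R: v(g)>0\}$ is the maximal ideal of $R$. For a face $\tau$ of $\sigma$, let $\Gamma_\tau=\Gamma\cap\tau^\perp$ and let $f_\tau=\sum_{m\in\Gamma_\tau}a_m\chi^m\in K[[\Gamma_\tau]]$ be the $\tau$-truncation of $f=\sum_{m\in\Gamma}a_m\chi^m$. The extended Newton diagram of $f_\tau$ is the convex hull of the union of the sets $m+\check\sigma_\tau$ for $m\in\Gamma_\tau$ with $a_m\neq0$, where $\check\sigma_\tau=\check\sigma\cap\tau^\perp$ is the cone generated by $\Gamma_\tau$; its Newton diagram is the union of the compact faces of the extended Newton diagram. The Newton cone $\mathcal{N}^\perp(f_\tau)\subseteq(N/N_\tau)_\mathbb{R}$ is the set of those $w$, nonnegative on $\Gamma_\tau$, which, as functions on the Newton diagram of $f_\tau$, attain their minimum on a face of positive dimension; if $f_\tau=0$, it is the set of all $w\in(N/N_\tau)_\mathbb{R}$ nonnegative on $\Gamma_\tau$. The extended Newton cone of $f$ is the disjoint union $\bigsqcup_{\tau\le\sigma}\mathcal{N}^\perp(f_\tau)\subseteq L$ over all faces $\tau$ of $\sigma$.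 Then, for every non-invertible $f\in K[[\Gamma]]$ (including $f=0$), $\mathrm{Trop}_{\ge0}(f)$ is equal to the extended Newton cone of $f$, and the closure of $\mathrm{Trop}_{>0}(f)$ in $\overline\sigma$ is equal to $\mathrm{Trop}_{\ge0}(f)$. -/

import Mathlib

open scoped TensorProduct Pointwise

namespace LocalTrop

noncomputable section

set_option linter.unusedSectionVars false

/-! ### Affine pointed semigroups and their cones -/

section Cones

variable {M : Type*} [AddCommGroup M]

/-- A pointed affine semigroup, realized as a finitely generated submonoid `Γ` of an abelian group
`M` (in the theorem `M` is a lattice generated by `Γ`, that is `M = M(Γ)`): finitely generated, and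
`0` is its only invertible element. -/
class PointedAffine (Γ : AddSubmonoid M) : Prop where
  fg : Γ.FG
  pointed : ∀ m ∈ Γ, -m ∈ Γ → m = 0

variable (M) in
/-- The real vector space `M_ℝ = M ⊗ ℝ`. -/
abbrev MR : Type _ := ℝ ⊗[ℤ] M

variable (M) in
/-- The real vector space `N_ℝ`, where `N = Hom(M, ℤ)`, as the dual of `M_ℝ`. -/
abbrev NR : Type _ := Module.Dual ℝ (MR M)

/-- The image in `M_ℝ` of an element of the lattice `M`. -/
def toMR (m : M) : MR M := (1 : ℝ) ⊗ₜ[ℤ] m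

theorem toMR_add (m n : M) : toMR (m + n) = toMR m + toMR n := TensorProduct.tmul_add _ _ _

theorem toMR_nsmul (k : ℕ) (m : M) : toMR (k • m) = (k : ℝ) • toMR m := by
  induction k with
  | zero => simp [toMR]
  | succ k ih => rw [succ_nsmul, toMR_add, ih]; push_cast; rw [add_smul, one_smul]

/-- The cone `σ̌(Γ) ⊆ M_ℝ`: all combinations with nonnegative real coefficients of elements
of `Γ`. -/
def dualCone (Γ : AddSubmonoid M) : Set (MR M) :=
  (PointedCone.hull ℝ (toMR '' (Γ : Set M)) : Set (MR M))

/-- The cone `σ(Γ)`: the linear functionals which are nonnegative on `σ̌(Γ)`. -/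
def cone (Γ : AddSubmonoid M) : Set (NR M) :=
  {w | ∀ x ∈ dualCone Γ, 0 ≤ w x}

/-- A (nonempty) face of a convex polyhedron `P`: the subset of `P` cut by a linear functional,
that is, the set where the functional reaches its minimum on `P`. The polyhedron itself is the
face cut by the zero functional. -/
def IsFace {V : Type*} [AddCommGroup V] [Module ℝ V] (P F : Set V) : Prop :=
  F.Nonempty ∧ ∃ l : Module.Dual ℝ V, F = {x ∈ P | ∀ y ∈ P, l x ≤ l y}

/-- The saturation of `Γ` in `M`: all `m` with `n m ∈ Γ` for some `n > 0`; it is the semigroup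
`σ̌(Γ) ∩ M`. -/
def sat (Γ : AddSubmonoid M) : AddSubmonoid M where
  carrier := {m | ∃ n : ℕ, 0 < n ∧ n • m ∈ Γ}
  zero_mem' := ⟨1, one_pos, by simp⟩
  add_mem' := by
    rintro a b ⟨n, hn, ha⟩ ⟨k, hk, hb⟩
    refine ⟨n * k, Nat.mul_pos hn hk, ?_⟩
    rw [smul_add]
    refine Γ.add_mem ?_ ?_
    · rw [mul_comm, mul_smul]; exact Γ.nsmul_mem ha k
    · rw [mul_smul]; exact Γ.nsmul_mem hb n

theorem le_sat (Γ : AddSubmonoid M) : Γ ≤ sat Γ := fun m hm => ⟨1, one_pos, by simpa using hm⟩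

theorem cone_nonneg_sat {Γ : AddSubmonoid M} {w : NR M} (hw : w ∈ cone Γ) {m : M}
    (hm : m ∈ sat Γ) : 0 ≤ w (toMR m) := by
  obtain ⟨n, hn, h⟩ := hm
  have h1 : 0 ≤ w (toMR (n • m)) :=
    hw _ (Submodule.subset_span (Set.mem_image_of_mem _ h))
  rw [toMR_nsmul, map_smul, smul_eq_mul] at h1
  exact nonneg_of_mul_nonneg_right h1 (by exact_mod_cast hn)

/-- The semigroup `Γ_τ = Γ ∩ τ^⊥`. -/
def perp (Γ : AddSubmonoid M) (τ : Set (NR M)) : AddSubmonoid M where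
  carrier := {m | m ∈ Γ ∧ ∀ u ∈ τ, u (toMR m) = 0}
  zero_mem' := ⟨Γ.zero_mem, fun u _ => by simp [toMR]⟩
  add_mem' := by
    rintro a b ⟨ha, ha'⟩ ⟨hb, hb'⟩
    exact ⟨Γ.add_mem ha hb, fun u hu => by rw [toMR_add, map_add, ha' u hu, hb' u hu, add_zero]⟩

end Cones

/-! ### The linear variety `L(σ, N)` and the extended cone -/

section LinearVariety

variable {M : Type*} [AddCommGroup M]

/-- The affine linear variety `L(σ, N) = Hom_Sg(σ̌ ∩ M, ℝ ∪ {+∞})`. -/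
abbrev LinVar (Γ : AddSubmonoid M) : Type _ := sat Γ →+ WithTop ℝ

/-- The topology of pointwise convergence on `L(σ, N)`, where `ℝ ∪ {+∞}` has the order topology. -/
instance (Γ : AddSubmonoid M) : TopologicalSpace (LinVar Γ) :=
  TopologicalSpace.induced (fun (ω : LinVar Γ) (m : sat Γ) => ω m) Pi.topologicalSpace

/-- The extended cone `σ̄`: the semigroup morphisms with nonnegative values. -/
def extCone (Γ : AddSubmonoid M) : Set (LinVar Γ) :=
  {ω | ∀ m, 0 ≤ ω m}

/-- The interior `σ̄°` of `σ̄`: the morphisms in `σ̄` which take only positive values on the maximal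
ideal of `σ̌ ∩ M`, that is, on its non-invertible elements. -/
def extConeInterior (Γ : AddSubmonoid M) : Set (LinVar Γ) :=
  {ω | ω ∈ extCone Γ ∧ ∀ m, ¬ IsAddUnit m → 0 < ω m}

/-- The closure of (the part in `A` of) a set `S` in the subspace `A` of a topological space. -/
def closureIn {X : Type*} [TopologicalSpace X] (A S : Set X) : Set X :=
  Subtype.val '' closure (Subtype.val ⁻¹' S : Set A)

theorem existsUnique_nsmul_eq (n : ℕ) (hn : 0 < n) (y : WithTop ℝ) :
    ∃! x : WithTop ℝ, n • x = y := by
  have hn' : (n : ℝ) ≠ 0 := by exact_mod_cast hn.ne'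
  have key : ∀ r : ℝ, n • (r : WithTop ℝ) = ((n * r : ℝ) : WithTop ℝ) := by
    intro r
    rw [← WithTop.coe_nsmul, nsmul_eq_mul]
  have keytop : n • (⊤ : WithTop ℝ) = ⊤ := by
    obtain ⟨k, rfl⟩ := Nat.exists_eq_succ_of_ne_zero hn.ne'
    rw [succ_nsmul, WithTop.add_top]
  induction y with
  | top =>
    refine ⟨⊤, keytop, fun x hx => ?_⟩
    induction x with
    | top => rfl
    | coe r => rw [key] at hx; exact absurd hx (WithTop.coe_ne_top)
  | coe s =>
    refine ⟨((s / n : ℝ) : WithTop ℝ), ?_, fun x hx => ?_⟩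
    · show n • ((s / n : ℝ) : WithTop ℝ) = _
      rw [key, mul_div_cancel₀ _ hn']
    · induction x with
      | top => rw [keytop] at hx; exact absurd hx.symm WithTop.coe_ne_top
      | coe r =>
        rw [key, WithTop.coe_inj] at hx
        rw [WithTop.coe_inj, ← hx, mul_div_cancel_left₀ _ hn']

/-- Restriction of a morphism from `σ̌ ∩ M` to `Γ`. -/
def restrict (Γ : AddSubmonoid M) (ω : LinVar Γ) : Γ →+ WithTop ℝ :=
  ω.comp (AddSubmonoid.inclusion (le_sat Γ))

/-- Every semigroup morphism `Γ → ℝ ∪ {+∞}` extends uniquely to `σ̌ ∩ M`. -/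
theorem restrict_bijective (Γ : AddSubmonoid M) : Function.Bijective (restrict Γ) := by
  constructor
  · intro ω₁ ω₂ h
    ext ⟨m, n, hn, hm⟩
    have h1 : ∀ ω : LinVar Γ,
        n • ω ⟨m, n, hn, hm⟩ = restrict Γ ω ⟨n • m, hm⟩ := by
      intro ω
      rw [← map_nsmul]
      rfl
    exact (existsUnique_nsmul_eq n hn (restrict Γ ω₁ ⟨n • m, hm⟩)).unique (h1 ω₁)
      (by rw [h1 ω₂, h])
  · intro h
    have hex : ∀ m : sat Γ, ∃ x : WithTop ℝ, ∀ (n : ℕ) (_ : 0 < n) (hm : n • (m : M) ∈ Γ),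
        n • x = h ⟨n • (m : M), hm⟩ := by
      rintro ⟨m, n, hn, hm⟩
      obtain ⟨x, hx, -⟩ := existsUnique_nsmul_eq n hn (h ⟨n • m, hm⟩)
      refine ⟨x, fun k hk hkm => ?_⟩
      refine (existsUnique_nsmul_eq n hn (n • h ⟨k • m, hkm⟩)).unique ?_ rfl
      rw [smul_comm, hx, ← map_nsmul, ← map_nsmul]
      exact congrArg h (Subtype.ext (smul_comm k n m))
    choose e he using hex
    have huniq : ∀ (m : sat Γ) (y : WithTop ℝ) (n : ℕ) (_ : 0 < n) (hm : n • (m : M) ∈ Γ),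
        n • y = h ⟨n • (m : M), hm⟩ → y = e m := fun m y n hn hm hy =>
      (existsUnique_nsmul_eq n hn _).unique hy (he m n hn hm)
    refine ⟨{ toFun := e, map_zero' := ?_, map_add' := ?_ }, ?_⟩
    · refine (huniq 0 0 1 one_pos (by simp) ?_).symm
      rw [smul_zero, ← map_zero h]
      congr 1
      ext
      simp
    · rintro ⟨a, n, hn, ha⟩ ⟨b, k, hk, hb⟩
      have hA : (n * k) • a ∈ Γ := by rw [mul_comm, mul_smul]; exact Γ.nsmul_mem ha k
      have hB : (n * k) • b ∈ Γ := by rw [mul_smul]; exact Γ.nsmul_mem hb n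
      have hnk := Nat.mul_pos hn hk
      refine (huniq _ _ (n * k) hnk
        (by simpa [smul_add] using Γ.add_mem hA hB) ?_).symm
      rw [smul_add, he ⟨a, n, hn, ha⟩ (n * k) hnk hA, he ⟨b, k, hk, hb⟩ (n * k) hnk hB, ← map_add]
      congr 1
      ext
      simp
    · ext ⟨m, hm⟩
      refine (huniq ⟨m, le_sat Γ hm⟩ (h ⟨m, hm⟩) 1 one_pos (by simpa using hm) ?_).symm
      rw [one_smul]
      congr 1
      ext
      simp

/-- The identification of `Hom_Sg(Γ, ℝ ∪ {+∞})` with `L(σ, N)`. -/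
def extend (Γ : AddSubmonoid M) (h : Γ →+ WithTop ℝ) : LinVar Γ :=
  (Equiv.ofBijective (restrict Γ) (restrict_bijective Γ)).symm h

end LinearVariety

/-! ### Valuations and tropicalization -/

section Tropicalization

variable {M : Type*} [AddCommGroup M] {R : Type*} [CommRing R]

/-- `𝒱(R)`: the real ring valuations `R → ℝ ∪ {+∞}`. -/
abbrev RealVal (R : Type*) [CommRing R] : Type _ := AddValuation R (WithTop ℝ)

/-- The nonnegative valuations of `R`, i.e. those centered in `R`. -/
def nonnegVals (R : Type*) [CommRing R] : Set (RealVal R) :=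
  {v | ∀ g, 0 ≤ v g}

/-- The local valuations of a local ring `R`: the valuations centered in `R` whose center
`{g | 0 < v g}` is the maximal ideal, i.e. the set of non-units of `R`. -/
def localVals (R : Type*) [CommRing R] : Set (RealVal R) :=
  {v | v ∈ nonnegVals R ∧ {g | 0 < v g} = nonunits R}

/-- The composition `v ∘ γ` of a valuation with a semigroup morphism `γ : (Γ, +) → (R, ·)`. -/
def compVal {Γ : AddSubmonoid M} (γ : Multiplicative Γ →* R) (v : RealVal R) :
    Γ →+ WithTop ℝ where
  toFun m := v (γ (Multiplicative.ofAdd m))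
  map_zero' := by simp
  map_add' a b := by simp

/-- The tropicalization map `Φ_γ : 𝒱(R) → L(σ, N)`, `v ↦ v ∘ γ`. -/
def tropMap {Γ : AddSubmonoid M} (γ : Multiplicative Γ →* R) (v : RealVal R) : LinVar Γ :=
  extend Γ (compVal γ v)

/-- The local nonnegative tropicalization of `γ`: the image under `Φ_γ` of all nonnegative
valuations of `R`. -/
def nonnegTrop {Γ : AddSubmonoid M} (γ : Multiplicative Γ →* R) : Set (LinVar Γ) :=
  tropMap γ '' nonnegVals R

/-- The local positive tropicalization of `γ`: the closure in `σ̄°` of the image under `Φ_γ` of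
the local valuations of `R`. -/
def posTrop {Γ : AddSubmonoid M} (γ : Multiplicative Γ →* R) : Set (LinVar Γ) :=
  closureIn (extConeInterior Γ) (tropMap γ '' localVals R)

end Tropicalization

/-! ### The formal toric ring `K[[Γ]]` -/

section SeriesRing

variable {M : Type*} [AddCommGroup M]

/-- In a pointed affine semigroup every element is in finitely many ways a sum of two elements. -/
theorem finite_pairs (Γ : AddSubmonoid M) [hΓ : PointedAffine Γ] (m : Γ) :
    {p : Γ × Γ | p.1 + p.2 = m}.Finite := by
  classical
  obtain ⟨S, hS⟩ := hΓ.fg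
  set T : Finset M := S.erase 0
  have hT : ∀ t : T, (t : M) ∈ Γ := fun t => by
    rw [← hS]; exact AddSubmonoid.subset_closure (Finset.mem_of_mem_erase t.2)
  let φ : (T → ℕ) →+ M :=
    { toFun := fun a => ∑ t, a t • (t : M)
      map_zero' := by simp
      map_add' := fun a b => by simp [add_smul, Finset.sum_add_distrib] }
  have hφΓ : ∀ a, φ a ∈ Γ := fun a => Γ.sum_mem fun t _ => Γ.nsmul_mem (hT t) _
  have hsurj : ∀ x ∈ Γ, ∃ a, φ a = x := by
    intro x hx
    have : Γ ≤ AddMonoidHom.mrange φ := by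
      rw [← hS, AddSubmonoid.closure_le]
      intro s hs
      by_cases h0 : s = 0
      · rw [h0]; exact (AddMonoidHom.mrange φ).zero_mem
      · refine ⟨Pi.single ⟨s, Finset.mem_erase.2 ⟨h0, hs⟩⟩ 1, ?_⟩
        show ∑ t : T, (Pi.single _ 1 : T → ℕ) t • (t : M) = s
        rw [Finset.sum_eq_single ⟨s, Finset.mem_erase.2 ⟨h0, hs⟩⟩]
        · simp
        · intro b _ hb; rw [Pi.single_eq_of_ne hb, zero_smul]
        · intro h; exact absurd (Finset.mem_univ _) h
    exact this hx
  have hzero : ∀ a, φ a = 0 → a = 0 := by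
    intro a ha
    ext t
    by_contra hne
    obtain ⟨k, hk⟩ := Nat.exists_eq_succ_of_ne_zero hne
    have h1 : φ a = (t : M) + (k • (t : M) + ∑ s ∈ Finset.univ.erase t, a s • (s : M)) := by
      show ∑ s, a s • (s : M) = _
      rw [← Finset.add_sum_erase _ _ (Finset.mem_univ t), hk, succ_nsmul]
      abel
    have h2 : -(t : M) = k • (t : M) + ∑ s ∈ Finset.univ.erase t, a s • (s : M) := by
      rw [ha] at h1
      exact (eq_neg_of_add_eq_zero_right h1.symm).symm
    have h3 : -(t : M) ∈ Γ := by
      rw [h2]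
      exact Γ.add_mem (Γ.nsmul_mem (hT t) _) (Γ.sum_mem fun s _ => Γ.nsmul_mem (hT s) _)
    exact (Finset.mem_erase.1 t.2).1 (hΓ.pointed _ (hT t) h3)
  have hfib : {a | φ a = (m : M)}.Finite := by
    refine WellQuasiOrderedLE.finite_of_isAntichain ?_
    intro a ha b hb hne hle
    apply hne
    have h1 : φ (b - a) = 0 := by
      have h2 : φ (b - a) + φ a = φ b := by rw [← map_add, tsub_add_cancel_of_le hle]
      rw [Set.mem_ofPred_eq] at ha hb
      rw [ha, hb] at h2
      simpa using h2
    have h3 := hzero _ h1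
    have h4 := tsub_add_cancel_of_le hle
    rw [h3, zero_add] at h4
    exact h4
  have hpairs : (⋃ a ∈ {a | φ a = (m : M)},
      (fun b : T → ℕ => (φ b, φ (a - b))) '' Set.Iic a).Finite :=
    hfib.biUnion fun a _ => (Set.finite_Iic a).image _
  refine Set.Finite.of_injOn (f := fun p : Γ × Γ => ((p.1 : M), (p.2 : M))) ?_ ?_ hpairs
  · rintro ⟨x, y⟩ hxy
    obtain ⟨a, ha⟩ := hsurj x x.2
    obtain ⟨b, hb⟩ := hsurj y y.2
    have hab : φ (a + b) = (m : M) := by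
      rw [map_add, ha, hb, ← AddSubmonoid.coe_add]
      exact congrArg _ hxy
    refine Set.mem_biUnion hab ⟨a, ?_, ?_⟩
    · intro t; simp
    · simp [ha, hb]
  · rintro ⟨x, y⟩ _ ⟨x', y'⟩ _ h
    simp only [Prod.mk.injEq, Subtype.coe_inj] at h
    exact Prod.ext h.1 h.2

instance (Γ : AddSubmonoid M) [PointedAffine Γ] : Finset.HasAntidiagonal Γ where
  antidiagonal m := (finite_pairs Γ m).toFinset
  mem_antidiagonal := by simp

/-- Formal power series `∑ a_m χ^m` with exponents in `Γ` and coefficients in `K`, as families of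
coefficients. -/
def Series (Γ : AddSubmonoid M) (K : Type*) : Type _ := Γ → K

namespace Series

variable {Γ : AddSubmonoid M} {K : Type*} [Field K]

/-- The coefficient `a_m` of `χ^m`. -/
def coeff (f : Series Γ K) (m : Γ) : K := f m

@[ext] theorem ext {f g : Series Γ K} (h : ∀ m, f.coeff m = g.coeff m) : f = g := funext h

instance : AddCommGroup (Series Γ K) := inferInstanceAs (AddCommGroup (Γ → K))

open Classical in
/-- The monomial `χ^m`. -/
def monomial (K : Type*) [Field K] (m : Γ) : Series Γ K := fun k => if k = m then 1 else 0

open Classical in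
theorem coeff_monomial (m k : Γ) : (monomial K m).coeff k = if k = m then 1 else 0 := rfl

variable [PointedAffine Γ]

instance : One (Series Γ K) := ⟨monomial K 0⟩

/-- The product of series: `(f g)_m = ∑_{a + b = m} f_a g_b`. -/
instance : Mul (Series Γ K) :=
  ⟨fun f g m => ∑ p ∈ Finset.HasAntidiagonal.antidiagonal m, f.coeff p.1 * g.coeff p.2⟩

@[simp] theorem coeff_zero (m : Γ) : (0 : Series Γ K).coeff m = 0 := rfl

@[simp] theorem coeff_add (f g : Series Γ K) (m : Γ) :
    (f + g).coeff m = f.coeff m + g.coeff m := rfl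

theorem coeff_mul (f g : Series Γ K) (m : Γ) :
    (f * g).coeff m = ∑ p ∈ Finset.HasAntidiagonal.antidiagonal m, f.coeff p.1 * g.coeff p.2 := rfl

theorem mul_comm' (f g : Series Γ K) : f * g = g * f := by
  ext m
  simp only [coeff_mul]
  refine Finset.sum_nbij' Prod.swap Prod.swap ?_ ?_ ?_ ?_ ?_ <;>
    simp [add_comm, mul_comm]

theorem mul_assoc' (f g h : Series Γ K) : f * g * h = f * (g * h) := by
  ext m
  simp only [coeff_mul, Finset.sum_mul, Finset.mul_sum, Finset.sum_sigma']
  refine Finset.sum_nbij' (fun ⟨⟨_, j⟩, ⟨k, l⟩⟩ => ⟨(k, l + j), (l, j)⟩)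
    (fun ⟨⟨i, _⟩, ⟨k, l⟩⟩ => ⟨(i + k, l), (i, k)⟩) ?_ ?_ ?_ ?_ ?_
  · rintro ⟨⟨i, j⟩, ⟨k, l⟩⟩ hp
    simp only [Finset.mem_sigma, Finset.HasAntidiagonal.mem_antidiagonal] at hp ⊢
    obtain ⟨h1, h2⟩ := hp
    exact ⟨by rw [← h1, ← h2, add_assoc], trivial⟩
  · rintro ⟨⟨i, j⟩, ⟨k, l⟩⟩ hp
    simp only [Finset.mem_sigma, Finset.HasAntidiagonal.mem_antidiagonal] at hp ⊢
    obtain ⟨h1, h2⟩ := hp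
    exact ⟨by rw [← h1, ← h2, add_assoc], trivial⟩
  · rintro ⟨⟨i, j⟩, ⟨k, l⟩⟩ hp
    simp only [Finset.mem_sigma, Finset.HasAntidiagonal.mem_antidiagonal] at hp
    obtain ⟨h1, h2⟩ := hp
    subst h2
    rfl
  · rintro ⟨⟨i, j⟩, ⟨k, l⟩⟩ hp
    simp only [Finset.mem_sigma, Finset.HasAntidiagonal.mem_antidiagonal] at hp
    obtain ⟨h1, h2⟩ := hp
    subst h2
    rfl
  · rintro ⟨⟨i, j⟩, ⟨k, l⟩⟩ _
    exact mul_assoc _ _ _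

theorem monomial_mul_coeff_add (m k : Γ) (f : Series Γ K) :
    (monomial K m * f).coeff (m + k) = f.coeff k := by
  rw [coeff_mul, Finset.sum_eq_single (m, k)]
  · simp [coeff_monomial]
  · rintro ⟨a, b⟩ hab hne
    rw [Finset.HasAntidiagonal.mem_antidiagonal] at hab
    by_cases ha : a = m
    · subst ha
      exact absurd (congrArg (Prod.mk a) (add_left_cancel (show a + b = a + k from hab))) hne
    · simp [coeff_monomial, ha]
  · intro h; simp at h

theorem one_mul' (f : Series Γ K) : 1 * f = f := by
  ext m
  have h := monomial_mul_coeff_add 0 m f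
  rw [zero_add] at h
  exact h

theorem add_mul' (f g h : Series Γ K) : (f + g) * h = f * h + g * h := by
  ext m
  simp [coeff_mul, add_mul, Finset.sum_add_distrib]

theorem zero_mul' (f : Series Γ K) : 0 * f = 0 := by
  ext m
  simp [coeff_mul]

/-- The ring structure on `K[[Γ]]`. -/
instance : CommRing (Series Γ K) :=
  { (inferInstance : AddCommGroup (Series Γ K)) with
    mul := (· * ·)
    one := 1
    mul_assoc := mul_assoc'
    mul_comm := mul_comm'
    one_mul := one_mul'
    mul_one := fun f => by rw [mul_comm', one_mul']
    zero_mul := zero_mul'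
    mul_zero := fun f => by rw [mul_comm', zero_mul']
    right_distrib := add_mul'
    left_distrib := fun f g h => by rw [mul_comm', add_mul', mul_comm' g, mul_comm' h] }

theorem monomial_add (m n : Γ) : monomial K (m + n) = monomial K m * monomial K n := by
  ext k
  rw [coeff_mul, coeff_monomial]
  by_cases hk : k = m + n
  · rw [if_pos hk, Finset.sum_eq_single (m, n)]
    · simp [coeff_monomial]
    · rintro ⟨a, b⟩ _ hne
      by_cases ha : a = m
      · have hb : b ≠ n := fun hb => hne (by rw [ha, hb])
        simp [coeff_monomial, hb]
      · simp [coeff_monomial, ha]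
    · intro h; exact absurd (by simp [hk]) h
  · rw [if_neg hk]
    refine (Finset.sum_eq_zero ?_).symm
    rintro ⟨a, b⟩ hab
    rw [Finset.HasAntidiagonal.mem_antidiagonal] at hab
    by_cases ha : a = m
    · have hb : b ≠ n := fun hb => hk (by rw [← hab, ha, hb])
      simp [coeff_monomial, hb]
    · simp [coeff_monomial, ha]

/-- The natural semigroup morphism `(Γ, +) → (K[[Γ]], ·)`, `m ↦ χ^m`. -/
def monomialHom (Γ : AddSubmonoid M) [PointedAffine Γ] (K : Type*) [Field K] :
    Multiplicative Γ →* Series Γ K where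
  toFun m := monomial K m.toAdd
  map_one' := rfl
  map_mul' _ _ := monomial_add _ _

end Series

/-- The natural semigroup morphism `Γ → K[[Γ]]/I`. -/
def quotHom {Γ : AddSubmonoid M} [PointedAffine Γ] {K : Type*} [Field K]
    (I : Ideal (Series Γ K)) : Multiplicative Γ →* (Series Γ K ⧸ I) :=
  (Ideal.Quotient.mk I : Series Γ K →* (Series Γ K ⧸ I)).comp (Series.monomialHom Γ K)

/-- `Trop_{≥0}(f)`: the local nonnegative tropicalization of `Γ → K[[Γ]]/(f)`. -/
def nnTropSeries {Γ : AddSubmonoid M} [PointedAffine Γ] {K : Type*} [Field K] (f : Series Γ K) :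
    Set (LinVar Γ) :=
  nonnegTrop (quotHom (Ideal.span {f}))

/-- `Trop_{>0}(f)`: the local positive tropicalization of `Γ → K[[Γ]]/(f)`. -/
def posTropSeries {Γ : AddSubmonoid M} [PointedAffine Γ] {K : Type*} [Field K] (f : Series Γ K) :
    Set (LinVar Γ) :=
  posTrop (quotHom (Ideal.span {f}))

end SeriesRing

/-! ### Newton diagrams and Newton cones -/

section Newton

variable {M : Type*} [AddCommGroup M] {K : Type*} [Field K]

/-- The extended Newton diagram of `f`: the convex hull of the union of the sets `m + σ̌(Γ)`, where
`m` runs through the exponents of the monomials of `f`. -/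
def newtonPlus {Γ : AddSubmonoid M} (f : Series Γ K) : Set (MR M) :=
  convexHull ℝ (⋃ m : {m : Γ // f.coeff m ≠ 0}, (toMR (m.1 : M)) +ᵥ dualCone Γ)

/-- `F` is a compact face of the extended Newton diagram of `f`, for the canonical topology of the
finite-dimensional vector space `M_ℝ`. -/
def IsCompactFace {Γ : AddSubmonoid M} (f : Series Γ K) (F : Set (MR M)) : Prop :=
  IsFace (newtonPlus f) F ∧ @IsCompact (MR M) (moduleTopology ℝ (MR M)) F

/-- The Newton diagram of `f`: the union of the compact faces of the extended Newton diagram. -/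
def newtonDiagram {Γ : AddSubmonoid M} (f : Series Γ K) : Set (MR M) :=
  ⋃₀ {F | IsCompactFace f F}

/-- The Newton cone of `f ∈ K[[Γ]]`: the `w ∈ σ(Γ)` which, as functions on the Newton diagram of
`f`, attain their minimum on a face of positive dimension; by definition it is `σ(Γ)` if `f = 0`.

If `Γ` does not generate `M`, the functionals `w ∈ N_ℝ` represent elements of `N(Γ)_ℝ`, the
quotient of `N_ℝ` by the functionals vanishing on `Γ`, and this set is the preimage of the Newton
cone in `N(Γ)_ℝ`. -/
def newtonCone {Γ : AddSubmonoid M} (f : Series Γ K) : Set (NR M) :=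
  {w | w ∈ cone Γ ∧ (f = 0 ∨ ∃ F, IsCompactFace f F ∧ F.Nontrivial ∧
    ∀ x ∈ F, ∀ y ∈ newtonDiagram f, w x ≤ w y)}

/-- The `τ`-truncation `f_τ ∈ K[[Γ_τ]]` of `f`. -/
def truncation {Γ : AddSubmonoid M} (τ : Set (NR M)) (f : Series Γ K) : Series (perp Γ τ) K :=
  fun m => f.coeff ⟨m.1, m.2.1⟩

open Classical in
/-- For a face `τ` of `σ`, the canonical map from (representatives in `N_ℝ` of) the stratum
`(N/N_τ)_ℝ` to `L(σ, N)`: the morphism is given by `w` on `τ^⊥ ∩ σ̌ ∩ M` and is `+∞` elsewhere on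
`σ̌ ∩ M`. -/
def stratumPoint {Γ : AddSubmonoid M} {τ : Set (NR M)} (hτ : IsFace (cone Γ) τ) (w : NR M) :
    LinVar Γ where
  toFun m := if ∀ u ∈ τ, u (toMR (m : M)) = 0 then ((w (toMR (m : M)) : ℝ) : WithTop ℝ) else ⊤
  map_zero' := by simp [toMR]
  map_add' a b := by
    have hsub : τ ⊆ cone Γ := by
      obtain ⟨-, l, rfl⟩ := hτ
      exact Set.sep_subset _ _
    have key : (∀ u ∈ τ, u (toMR ((a + b : sat Γ) : M)) = 0) ↔
        (∀ u ∈ τ, u (toMR (a : M)) = 0) ∧ (∀ u ∈ τ, u (toMR (b : M)) = 0) := by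
      rw [AddSubmonoid.coe_add, toMR_add]
      constructor
      · intro h
        have h' : ∀ u ∈ τ, u (toMR (a : M)) = 0 ∧ u (toMR (b : M)) = 0 := by
          intro u hu
          have h1 := h u hu
          rw [map_add] at h1
          exact (add_eq_zero_iff_of_nonneg (cone_nonneg_sat (hsub hu) a.2)
            (cone_nonneg_sat (hsub hu) b.2)).1 h1
        exact ⟨fun u hu => (h' u hu).1, fun u hu => (h' u hu).2⟩
      · rintro ⟨h1, h2⟩ u hu
        rw [map_add, h1 u hu, h2 u hu, add_zero]
    by_cases ha : ∀ u ∈ τ, u (toMR (a : M)) = 0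
    · by_cases hb : ∀ u ∈ τ, u (toMR (b : M)) = 0
      · rw [if_pos ha, if_pos hb, if_pos (key.2 ⟨ha, hb⟩), AddSubmonoid.coe_add, toMR_add, map_add,
          WithTop.coe_add]
      · rw [if_neg hb, if_neg (fun h => hb (key.1 h).2), WithTop.add_top]
    · rw [if_neg ha, if_neg (fun h => ha (key.1 h).1), WithTop.top_add]

/-- The extended Newton cone of `f`: the disjoint union over the faces `τ` of `σ` of the Newton
cones of the truncations `f_τ`, each of them in the stratum `(N/N_τ)_ℝ` of `L(σ, N)`. -/
def extendedNewtonCone {Γ : AddSubmonoid M} (f : Series Γ K) : Set (LinVar Γ) :=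
  ⋃ (τ : Set (NR M)) (hτ : IsFace (cone Γ) τ), stratumPoint hτ '' newtonCone (truncation τ f)

end Newton

end

end LocalTrop

/-! Pulled back to `K[[Γ]]`, a point of Trop_{≥0}(f) is the family of values on monomials of a
nonnegative valuation that is infinite on `f`. The monomials of finite value form a face of `Γ`,
which by Farkas' lemma is `Γ_τ` for some face `τ` of `σ`, and a real valued morphism on `Γ_τ` is
given by a weight `w`. Since `K[[Γ_τ]]` is both a subring and a quotient of `K[[Γ]]`, the first
equality reduces to one question: given a weight `w ≥ 0` on `Γ`, when is there a nonnegative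
valuation with `v(χ^m) = w(m)` and `v(f) = ∞`? The answer is: when `f = 0` or two exponents of `f`
are minimal both for `w` and for one functional positive on `Γ∖{0}` (`IsTie`). By
`mem_newtonCone_iff` this is the Newton cone condition.

Necessity (`isTie_of_val`). Without a tie, every positive functional has exactly one minimizer among
the `w`-minimal exponents; by connectedness it is always the same `m₀`, and Farkas' lemma puts these
exponents in `m₀ + sat Γ`. After a finite extension of `Γ` inside its saturation, the `w`-minimal
part `p` of `f` is `χ^{m₀}` times a unit. A conductor `c` clears the extension: `q p = χ^{c + m₀}`
with `v(q) ≥ w(c)`. But `v(f) = ∞` forces `v(p) > w(m₀)`, a contradiction. No continuity of `v` is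
needed: by Dickson's lemma a series is a finite combination of its own monomials with series as
coefficients (`le_val`).

Sufficiency (`exists_val_of_isTie`). The monomial norm `e^{-w}` induces a residue seminorm modulo
`f` after inverting monomials. With a tie, no multiple of `f` is `χ^c` plus terms of larger weight,
because a product with `f` has two distinct extreme lowest terms that cannot cancel
(`IsTie.exists_weight_le`); so `1` has seminorm `1`. A minimal seminorm below it is multiplicative,
as in the proof that a Berkovich spectrum is nonempty, and the monomials, already multiplicative,
keep their values.

Closure. Through `t ↦ e^{-t}` the nonnegative valuations infinite on `f` form a compact set of
functions, so Trop_{≥0}(f) is closed. Conversely `w + ε l`, with `l` the positive functional of the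
tie, stays in the Newton cone of the same stratum, comes from a local valuation, and tends to `w`.
-/

namespace LocalTrop

noncomputable section

set_option linter.unusedSectionVars false

/-! ### Farkas' lemma -/

/-- **Farkas' lemma** over a linearly ordered field, for finitely many functionals. -/
theorem exists_nonneg_eq_sum {k V : Type*} [Field k] [LinearOrder k] [IsStrictOrderedRing k]
    [AddCommGroup V] [Module k V] (n : ℕ) :
    ∀ (a : Fin n → Module.Dual k V) (b : Module.Dual k V),
      (∀ x, (∀ i, 0 ≤ a i x) → 0 ≤ b x) →
      ∃ c : Fin n → k, (∀ i, 0 ≤ c i) ∧ b = ∑ i, c i • a i := by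
  induction n with
  | zero =>
    intro a b h
    refine ⟨0, fun i => i.elim0, ?_⟩
    ext x
    have h1 := h x (fun i => i.elim0)
    have h2 := h (-x) (fun i => i.elim0)
    rw [map_neg] at h2
    simp only [Finset.univ_eq_empty, Finset.sum_empty, LinearMap.zero_apply]
    linarith
  | succ n ih =>
    intro a b h
    by_cases h0 : ∀ x, (∀ i : Fin n, 0 ≤ a i.succ x) → 0 ≤ b x
    · obtain ⟨c, hc, hb⟩ := ih (fun i => a i.succ) b h0
      refine ⟨Fin.cons 0 c, fun i => ?_, ?_⟩
      · refine Fin.cases ?_ (fun i => ?_) i <;> simp [hc]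
      · rw [Fin.sum_univ_succ]; simpa using hb
    · push Not at h0
      obtain ⟨x₀, hx, hbx⟩ := h0
      have ha0 : a 0 x₀ < 0 := by
        by_contra hge
        push Not at hge
        exact absurd (h x₀ (Fin.cases hge hx)) (not_le.2 hbx)
      -- The multiples of `a 0` are chosen so that all the new functionals vanish at `x₀`. Their
      -- value at `x` is then that of the old ones at the projection of `x` along `x₀` to the kernel
      -- of `a 0`, where the original hypothesis applies.
      obtain ⟨c, hc, hb⟩ := ih (fun i => a i.succ - (a i.succ x₀ / a 0 x₀) • a 0)
        (b - (b x₀ / a 0 x₀) • a 0) (by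
          intro x hxi
          have hy : ∀ i, 0 ≤ a i (x - (a 0 x / a 0 x₀) • x₀) := by
            refine Fin.cases ?_ fun i => ?_
            · simp only [map_sub, map_smul, smul_eq_mul]
              rw [div_mul_cancel₀ _ ha0.ne, sub_self]
            · have := hxi i
              simp only [map_sub, map_smul, smul_eq_mul, LinearMap.sub_apply,
                LinearMap.smul_apply] at this ⊢
              convert this using 2
              ring
          have := h _ hy
          simp only [map_sub, map_smul, smul_eq_mul, LinearMap.sub_apply,
            LinearMap.smul_apply] at this ⊢
          convert this using 2
          ring)
      -- The coefficient of `a 0` is nonnegative because `a 0` and `b` are negative at `x₀` while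
      -- the other functionals are nonnegative there.
      refine ⟨Fin.cons (b x₀ / a 0 x₀ - ∑ i, c i * (a i.succ x₀ / a 0 x₀)) c, fun i => ?_, ?_⟩
      · refine Fin.cases ?_ (fun i => ?_) i
        · rw [Fin.cons_zero, sub_nonneg]
          exact (Finset.sum_nonpos fun i _ => mul_nonpos_of_nonneg_of_nonpos (hc i)
            (div_nonpos_of_nonneg_of_nonpos (hx i) ha0.le)).trans
            (div_nonneg_of_nonpos hbx.le ha0.le)
        · simpa using hc i
      · rw [Fin.sum_univ_succ]
        simp only [Fin.cons_zero, Fin.cons_succ]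
        simp only [smul_sub, Finset.sum_sub_distrib, smul_smul, ← Finset.sum_smul] at hb
        rw [sub_eq_iff_eq_add] at hb
        refine hb.trans ?_
        module

/-! ### Lattice points, functionals and saturation -/

section Lattice

variable {M : Type*} [AddCommGroup M]

theorem toMR_zero : toMR (0 : M) = 0 := TensorProduct.tmul_zero _ _

theorem toMR_sub (m n : M) : toMR (m - n) = toMR m - toMR n := TensorProduct.tmul_sub _ _ _

/-- The element of `N_ℝ` defined by a real valued morphism on the lattice. -/
def functionalOf (u : M →+ ℝ) : NR M :=
  TensorProduct.AlgebraTensorModule.lift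
    (LinearMap.toSpanSingleton ℝ (M →ₗ[ℤ] ℝ) u.toIntLinearMap)

theorem functionalOf_toMR (u : M →+ ℝ) (m : M) : functionalOf u (toMR m) = u m := by
  simp [functionalOf, toMR]

theorem mem_cone_iff {Γ : AddSubmonoid M} {w : NR M} :
    w ∈ cone Γ ↔ ∀ m ∈ Γ, 0 ≤ w (toMR m) := by
  constructor
  · intro h m hm
    exact h _ (Submodule.subset_span (Set.mem_image_of_mem _ hm))
  · intro h x hx
    refine Submodule.span_induction (p := fun x _ => 0 ≤ w x) ?_ ?_ ?_ ?_ hx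
    · rintro _ ⟨m, hm, rfl⟩; exact h m hm
    · simp
    · intro x y _ _ hx hy; rw [map_add]; exact add_nonneg hx hy
    · rintro ⟨a, ha⟩ x _ hx
      show 0 ≤ w (a • x)
      rw [map_smul]
      exact mul_nonneg ha hx

/-- An element of a lattice on which all the functionals of `σ(Γ)` are nonnegative belongs to the
saturation of `Γ`. -/
theorem mem_sat_of_forall_cone [Module.Free ℤ M] [Module.Finite ℤ M] {Γ : AddSubmonoid M}
    (hΓ : Γ.FG) {x : M} (hx : ∀ u ∈ cone Γ, 0 ≤ u (toMR x)) : x ∈ sat Γ := by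
  classical
  obtain ⟨S, hS⟩ := hΓ
  let e := S.equivFin.symm
  let ev : M → Module.Dual ℚ (M →ₗ[ℤ] ℚ) := fun m =>
    { toFun := fun u => u m
      map_add' := fun _ _ => rfl
      map_smul' := fun _ _ => rfl }
  -- Farkas' lemma is used over `ℚ`, on the space of morphisms `M → ℚ`, so that the coefficients are
  -- rational and a multiple of `x` is an integral combination of generators.
  obtain ⟨c, hc, hsum⟩ := exists_nonneg_eq_sum S.card (fun i => ev (e i)) (ev x) (by
    intro u hu
    have hcone : functionalOf ((Rat.castHom ℝ).toAddMonoidHom.comp u.toAddMonoidHom) ∈ cone Γ := by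
      rw [mem_cone_iff]
      intro m hm
      rw [functionalOf_toMR]
      rw [← hS] at hm
      refine AddSubmonoid.closure_induction (motive := fun m _ => (0 : ℝ) ≤
        ((Rat.castHom ℝ).toAddMonoidHom.comp u.toAddMonoidHom) m) ?_ ?_ ?_ hm
      · intro s hs
        have := hu (e.symm ⟨s, hs⟩)
        rw [Equiv.apply_symm_apply] at this
        exact Rat.cast_nonneg.2 this
      · simp
      · intro a b _ _ ha hb; rw [map_add]; exact add_nonneg ha hb
    have := hx _ hcone
    rw [functionalOf_toMR] at this
    exact Rat.cast_nonneg.1 this)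
  let d : ℕ := ∏ i, (c i).den
  have hd : 0 < d := Finset.prod_pos fun i _ => (c i).den_pos
  have hdc : ∀ i, ∃ k : ℕ, (d : ℚ) * c i = k := by
    intro i
    obtain ⟨q, hq⟩ : (c i).den ∣ d := Finset.dvd_prod_of_mem _ (Finset.mem_univ i)
    refine ⟨q * (c i).num.toNat, ?_⟩
    have h1 : ((c i).num.toNat : ℚ) = (c i).num := by
      exact_mod_cast Int.toNat_of_nonneg (Rat.num_nonneg.2 (hc i))
    rw [hq]
    push_cast
    rw [h1, mul_comm ((c i).den : ℚ), mul_assoc, Rat.den_mul_eq_num]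
  choose k hk using hdc
  refine ⟨d, hd, ?_⟩
  have key : d • x = ∑ i, k i • (e i : M) := by
    refine (Module.Free.chooseBasis ℤ M).ext_elem fun j => ?_
    let u : M →ₗ[ℤ] ℚ := (Int.castAddHom ℚ).toIntLinearMap.comp
      ((Module.Free.chooseBasis ℤ M).coord j)
    have h1 : u (d • x) = u (∑ i, k i • (e i : M)) := by
      rw [map_nsmul, map_sum]
      have h2 : u x = ∑ i, c i * u (e i) := by
        have := congrArg (fun φ => φ u) hsum
        simpa [ev] using this
      rw [h2, nsmul_eq_mul, Finset.mul_sum]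
      refine Finset.sum_congr rfl fun i _ => ?_
      rw [map_nsmul, nsmul_eq_mul, ← mul_assoc, hk]
    exact Int.cast_injective (α := ℚ) h1
  rw [key]
  refine Γ.sum_mem fun i _ => Γ.nsmul_mem ?_ _
  rw [← hS]
  exact AddSubmonoid.subset_closure (e i).2

theorem functional_separates [Module.Free ℤ M] [Module.Finite ℤ M] {m : M} (hm : m ≠ 0) :
    ∃ u : NR M, u (toMR m) ≠ 0 := by
  obtain ⟨j, hj⟩ : ∃ j, (Module.Free.chooseBasis ℤ M).coord j m ≠ 0 := by
    by_contra! h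
    exact hm ((Module.Free.chooseBasis ℤ M).ext_elem fun j => by simpa using h j)
  refine ⟨functionalOf ((Int.castAddHom ℝ).comp
    ((Module.Free.chooseBasis ℤ M).coord j).toAddMonoidHom), ?_⟩
  rw [functionalOf_toMR]
  simpa using hj

/-- A lattice embeds in a group of integer vectors. The property plays the role of the fact that a
Minkowski sum of two polytopes, not both points, has at least two vertices, each a sum in only one
way. -/
theorem twoUniqueSums_of_lattice [Module.Free ℤ M] : TwoUniqueSums M :=
  TwoUniqueSums.of_injective_addHom
    ((Module.Free.chooseBasis ℤ M).repr.toLinearMap.toAddMonoidHom.toAddHom)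
    (Module.Free.chooseBasis ℤ M).repr.injective inferInstance

end Lattice

/-! ### Multiplicative seminorms -/

section Seminorms

variable {A : Type*} [CommRing A]

/-- The nonarchimedean seminorms of norm `1` at `1` bounded by `p` and compatible with the
multiplicative elements of `p`. -/
structure IsBoundedSeminorm (p q : A → ℝ) : Prop where
  nonneg : ∀ x, 0 ≤ q x
  zero : q 0 = 0
  one : q 1 = 1
  neg : ∀ x, q (-x) = q x
  add : ∀ x y, q (x + y) ≤ max (q x) (q y)
  mul : ∀ x y, q (x * y) ≤ q x * q y
  le : ∀ x, q x ≤ p x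
  isMul : ∀ x, (∀ y, p (x * y) = p x * p y) → ∀ y, q (x * y) = p x * q y

namespace IsBoundedSeminorm

variable {p q : A → ℝ}

/-- The bundled seminorm. -/
def toRingSeminorm (h : IsBoundedSeminorm p q) : RingSeminorm A where
  toFun := q
  map_zero' := h.zero
  add_le' x y := (h.add x y).trans (max_le_add_of_nonneg (h.nonneg x) (h.nonneg y))
  neg' := h.neg
  mul_le' := h.mul

/-- Taking `y = 1` in `isMul` shows that the multiplicative elements of `p` have the same value for
every seminorm of the class. This is what preserves the values of monomials when the seminorm is
made smaller. -/
theorem isMul_self (h : IsBoundedSeminorm p q) {x : A} (hx : ∀ y, p (x * y) = p x * p y) :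
    q x = p x ∧ ∀ y, q (x * y) = q x * q y := by
  have h1 : q x = p x := by simpa [h.one] using h.isMul x hx 1
  exact ⟨h1, fun y => by rw [h.isMul x hx, h1]⟩

/-- Replacing `q x` by the limit of `q (x ^ n) ^ (1 / n)` makes the seminorm power-multiplicative
without leaving the class or increasing it. -/
theorem smoothing (h : IsBoundedSeminorm p q) :
    IsBoundedSeminorm p (smoothingFun h.toRingSeminorm) := by
  have h1 : h.toRingSeminorm 1 ≤ 1 := h.one.le
  have hna : IsNonarchimedean h.toRingSeminorm := h.add
  let s := smoothingSeminorm h.toRingSeminorm h1 hna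
  refine ⟨fun x => apply_nonneg s x, map_zero s, ?_, fun x => map_neg_eq_map s x,
    isNonarchimedean_smoothingFun _ h1 hna, fun x y => map_mul_le_mul s x y,
    fun x => (smoothingFun_le_self h.toRingSeminorm x).trans (h.le x), fun x hx y => ?_⟩
  · refine (smoothingFun_apply_of_map_mul_eq_mul h.toRingSeminorm h1 (x := 1) fun y => ?_).trans
      h.one
    show q (1 * y) = q 1 * q y
    rw [one_mul, h.one, one_mul]
  · have h2 := h.isMul_self hx
    rw [smoothingFun_of_map_mul_eq_mul h.toRingSeminorm h1 h2.2,
      smoothingFun_apply_of_map_mul_eq_mul h.toRingSeminorm h1 h2.2]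
    exact congrArg (· * _) h2.1

/-- Replacing `q x` by the limit of `q (x * c ^ n) / q c ^ n` makes `c` a multiplicative element,
again without leaving the class or increasing the seminorm. -/
theorem fromConst (h : IsBoundedSeminorm p q) (hpm : IsPowMul q) {c : A} (hc : q c ≠ 0) :
    IsBoundedSeminorm p (seminormFromConst' c h.toRingSeminorm) := by
  have h1 : h.toRingSeminorm 1 ≤ 1 := h.one.le
  have hna : IsNonarchimedean h.toRingSeminorm := h.add
  have hpm' : IsPowMul h.toRingSeminorm := hpm
  have hc' : h.toRingSeminorm c ≠ 0 := hc
  let s := seminormFromConst h1 hc' hpm'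
  refine ⟨fun x => apply_nonneg s x, map_zero s, seminormFromConst_one h1 hc' hpm',
    fun x => map_neg_eq_map s x, seminormFromConst_isNonarchimedean h1 hc' hpm' hna,
    fun x y => map_mul_le_mul s x y,
    fun x => (seminormFromConst_le_seminorm h1 hc' hpm' x).trans (h.le x), fun x hx y => ?_⟩
  have h2 := h.isMul_self hx
  rw [seminormFromConst_isMul_of_isMul h1 hc' hpm' h2.2,
    seminormFromConst_apply_of_isMul h1 hc' hpm' h2.2]
  exact congrArg (· * _) h2.1

/-- A minimal bounded seminorm is multiplicative. -/
theorem map_mul_of_minimal (h : IsBoundedSeminorm p q)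
    (hmin : ∀ q', IsBoundedSeminorm p q' → q' ≤ q → q' = q) (x y : A) : q (x * y) = q x * q y := by
  have h1 : h.toRingSeminorm 1 ≤ 1 := h.one.le
  have hpm : IsPowMul q := by
    have := hmin _ h.smoothing (smoothingFun_le_self h.toRingSeminorm)
    rw [← this]
    exact isPowMul_smoothingFun _ h1
  by_cases hx : q x = 0
  · refine le_antisymm (h.mul x y) ?_
    rw [hx, zero_mul]
    exact h.nonneg _
  · have hx' : h.toRingSeminorm x ≠ 0 := hx
    have := hmin _ (h.fromConst hpm hx) (seminormFromConst_le_seminorm h1 hx' hpm)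
    rw [← this]
    exact seminormFromConst_const_mul h1 hx' hpm y

/-- Zorn's lemma for the reversed order: the pointwise infimum of a chain stays in the class. The
inequalities for sums and products survive because two members of a chain that are small at `x` and
at `y` have a common lower bound in it; the value at `1` is fixed, so the infimum is not zero. -/
theorem exists_minimal (hp : IsBoundedSeminorm p p) :
    ∃ q, IsBoundedSeminorm p q ∧ ∀ q', IsBoundedSeminorm p q' → q' ≤ q → q' = q := by
  have key : ∀ C : Set (A → ℝ)ᵒᵈ, C ⊆ {q | IsBoundedSeminorm p (OrderDual.ofDual q)} →
      IsChain (· ≤ ·) C → ∀ q₀ ∈ C,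
      ∃ ub ∈ {q : (A → ℝ)ᵒᵈ | IsBoundedSeminorm p (OrderDual.ofDual q)}, ∀ z ∈ C, z ≤ ub := by
    intro C hC hchain q₀ hq₀
    have : Nonempty C := ⟨⟨q₀, hq₀⟩⟩
    let Q : C → A → ℝ := fun i => OrderDual.ofDual i.1
    have hQ : ∀ i, IsBoundedSeminorm p (Q i) := fun i => hC i.2
    have hdir : ∀ i j, ∃ k, Q k ≤ Q i ∧ Q k ≤ Q j := by
      intro i j
      rcases hchain.total i.2 j.2 with hij | hij
      · exact ⟨j, hij, le_rfl⟩
      · exact ⟨i, le_rfl, hij⟩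
    have hbdd : ∀ x, BddBelow (Set.range fun i => Q i x) := fun x =>
      ⟨0, by rintro _ ⟨i, rfl⟩; exact (hQ i).nonneg x⟩
    have hlt : ∀ x r, (⨅ i, Q i x) < r → ∃ i, Q i x < r := fun x r h => exists_lt_of_ciInf_lt h
    refine ⟨OrderDual.toDual fun x => ⨅ i, Q i x, ?_, fun z hz x => ciInf_le (hbdd x) ⟨z, hz⟩⟩
    refine ⟨fun x => le_ciInf fun i => (hQ i).nonneg x, ?_, ?_, ?_, ?_, ?_, ?_, ?_⟩
    · simp [(hQ _).zero]
    · simp [(hQ _).one]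
    · intro x; simp [(hQ _).neg]
    · intro x y
      refine le_of_forall_gt_imp_ge_of_dense fun r hr => ?_
      obtain ⟨i, hi⟩ := hlt x r ((le_max_left _ _).trans_lt hr)
      obtain ⟨j, hj⟩ := hlt y r ((le_max_right _ _).trans_lt hr)
      obtain ⟨k, hki, hkj⟩ := hdir i j
      exact (ciInf_le (hbdd _) k).trans (((hQ k).add x y).trans
        (max_le ((hki x).trans hi.le) ((hkj y).trans hj.le)))
    · intro x y
      refine le_mul_of_forall_lt₀ fun a ha b hb => ?_
      obtain ⟨i, hi⟩ := hlt x a ha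
      obtain ⟨j, hj⟩ := hlt y b hb
      obtain ⟨k, hki, hkj⟩ := hdir i j
      exact (ciInf_le (hbdd _) k).trans (((hQ k).mul x y).trans
        (mul_le_mul ((hki x).trans hi.le) ((hkj y).trans hj.le) ((hQ k).nonneg y)
          (((hQ i).nonneg x).trans hi.le)))
    · intro x
      exact (ciInf_le (hbdd x) (Classical.arbitrary _)).trans ((hQ _).le x)
    · intro x hx y
      show ⨅ i, Q i (x * y) = p x * ⨅ i, Q i y
      rw [Real.mul_iInf_of_nonneg (hp.nonneg x)]
      exact iInf_congr fun i => (hQ i).isMul x hx y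
  obtain ⟨q, -, hq⟩ := zorn_le_nonempty₀ (α := (A → ℝ)ᵒᵈ) _ key (OrderDual.toDual p) hp
  exact ⟨OrderDual.ofDual q, hq.prop, fun q' hq' hle => hq.eq_of_ge hq' hle⟩

end IsBoundedSeminorm

end Seminorms

/-! ### Real valuations and multiplicative seminorms -/

section ExpNeg

/-- The order reversing homeomorphism `t ↦ exp (-t)` from `ℝ ∪ {+∞}` to `[0, +∞)`. -/
def expNeg : WithTop ℝ → ℝ := fun t => t.recTopCoe 0 fun r => Real.exp (-r)

@[simp] theorem expNeg_top : expNeg ⊤ = 0 := rfl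

@[simp] theorem expNeg_coe (r : ℝ) : expNeg (r : WithTop ℝ) = Real.exp (-r) := rfl

@[simp] theorem expNeg_zero : expNeg 0 = 1 := by
  rw [← WithTop.coe_zero, expNeg_coe]; simp

theorem expNeg_add (s t : WithTop ℝ) : expNeg (s + t) = expNeg s * expNeg t := by
  induction s with
  | top => simp
  | coe r =>
    induction t with
    | top => simp
    | coe r' =>
      rw [← WithTop.coe_add, expNeg_coe, expNeg_coe, expNeg_coe, neg_add, Real.exp_add]

theorem expNeg_nonneg (t : WithTop ℝ) : 0 ≤ expNeg t := by
  induction t with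
  | top => simp
  | coe r => exact (Real.exp_pos _).le

theorem expNeg_strictAnti : StrictAnti expNeg := by
  intro s t hst
  induction t with
  | top =>
    induction s with
    | top => exact absurd hst (lt_irrefl _)
    | coe r => exact Real.exp_pos _
  | coe r' =>
    induction s with
    | top => exact absurd hst not_top_lt
    | coe r => simpa using WithTop.coe_lt_coe.1 hst

theorem exists_expNeg_eq {x : ℝ} (hx : 0 ≤ x) : ∃ t, expNeg t = x := by
  rcases hx.eq_or_lt with rfl | hx
  · exact ⟨⊤, rfl⟩
  · exact ⟨((-Real.log x : ℝ) : WithTop ℝ), by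
      rw [expNeg_coe, neg_neg, Real.exp_log hx]⟩

theorem continuous_expNeg : Continuous expNeg := by
  rw [continuous_iff_continuousAt]
  intro t
  induction t with
  | coe r =>
    have h : ContinuousAt (expNeg ∘ ((↑) : ℝ → WithTop ℝ)) r :=
      (Real.continuous_exp.comp continuous_neg).continuousAt
    rw [ContinuousAt, WithTop.nhds_coe, Filter.tendsto_map'_iff]
    exact h
  | top =>
    rw [ContinuousAt, Metric.tendsto_nhds]
    intro ε hε
    obtain ⟨t, ht⟩ := exists_expNeg_eq hε.le
    have hlt : t < ⊤ := by
      rw [lt_top_iff_ne_top]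
      rintro rfl
      exact hε.ne ht
    filter_upwards [lt_mem_nhds hlt] with s hs
    rw [expNeg_top, dist_zero_right, Real.norm_of_nonneg (expNeg_nonneg s), ← ht]
    exact expNeg_strictAnti hs

/-- Multiplicative nonarchimedean seminorms. -/
structure IsMulSeminorm {A : Type*} [CommRing A] (q : A → ℝ) : Prop where
  nonneg : ∀ x, 0 ≤ q x
  zero : q 0 = 0
  one : q 1 = 1
  add : ∀ x y, q (x + y) ≤ max (q x) (q y)
  mul : ∀ x y, q (x * y) = q x * q y

/-- Every multiplicative nonarchimedean seminorm is the exponential of a real valuation. -/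
theorem IsMulSeminorm.exists_val {A : Type*} [CommRing A] {q : A → ℝ} (hq : IsMulSeminorm q) :
    ∃ v : RealVal A, ∀ x, expNeg (v x) = q x := by
  choose v hv using fun x => exists_expNeg_eq (hq.nonneg x)
  have hinj := expNeg_strictAnti.injective
  refine ⟨AddValuation.of v ?_ ?_ ?_ ?_, hv⟩
  · apply hinj; rw [hv, hq.zero, expNeg_top]
  · apply hinj; rw [hv, hq.one, expNeg_zero]
  · intro x y
    have h := hq.add x y
    simp only [← hv] at h
    rw [← expNeg_strictAnti.antitone.map_min] at h
    exact expNeg_strictAnti.le_iff_ge.1 h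
  · intro x y
    apply hinj
    rw [hv, hq.mul, expNeg_add, hv, hv]

theorem isMulSeminorm_expNeg {A : Type*} [CommRing A] (v : RealVal A) :
    IsMulSeminorm fun x => expNeg (v x) := by
  refine ⟨fun x => expNeg_nonneg _, by simp, by simp, fun x y => ?_, fun x y => ?_⟩
  · rw [← expNeg_strictAnti.antitone.map_min]
    exact expNeg_strictAnti.antitone (v.map_add x y)
  · rw [v.map_mul, expNeg_add]

end ExpNeg

/-! ### Weights and finiteness properties of affine semigroups -/

section Semigroups

variable {M : Type*} [AddCommGroup M]

/-- The real valued morphism on the lattice defined by an element of `N_ℝ`. -/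
def weight (w : NR M) : M →+ ℝ where
  toFun m := w (toMR m)
  map_zero' := by rw [toMR_zero, map_zero]
  map_add' a b := by rw [toMR_add, map_add]

theorem weight_apply (w : NR M) (m : M) : weight w m = w (toMR m) := rfl

theorem weight_add (w u : NR M) (m : M) : weight (w + u) m = weight w m + weight u m := rfl

theorem weight_smul (c : ℝ) (w : NR M) (m : M) : weight (c • w) m = c * weight w m := rfl

theorem weight_nonneg {Γ : AddSubmonoid M} {w : NR M} (hw : w ∈ cone Γ) {m : M} (hm : m ∈ Γ) :
    0 ≤ weight w m := mem_cone_iff.1 hw m hm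

/-- The functionals which are positive on the nonzero elements of `Γ`. -/
def IsPositive (Γ : AddSubmonoid M) (l : NR M) : Prop :=
  ∀ m ∈ Γ, m ≠ 0 → 0 < weight l m

theorem IsPositive.mem_cone {Γ : AddSubmonoid M} {l : NR M} (hl : IsPositive Γ l) :
    l ∈ cone Γ := by
  rw [mem_cone_iff]
  intro m hm
  by_cases h : m = 0
  · rw [h, toMR_zero, map_zero]
  · exact (hl m hm h).le

theorem IsPositive.add_smul {Γ : AddSubmonoid M} {l w : NR M} (hl : IsPositive Γ l)
    (hw : w ∈ cone Γ) {ε : ℝ} (hε : 0 < ε) : IsPositive Γ (w + ε • l) := fun m hm h0 => by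
  rw [weight_add, weight_smul]
  exact add_pos_of_nonneg_of_pos (weight_nonneg hw hm) (mul_pos hε (hl m hm h0))

/-- **Dickson's lemma**: every subset of a finitely generated commutative semigroup is contained in
the ideal generated by a finite part of it. -/
theorem exists_finset_subset_add {Γ : AddSubmonoid M} (hΓ : Γ.FG) (S : Set Γ) :
    ∃ T : Finset Γ, (T : Set Γ) ⊆ S ∧ ∀ m ∈ S, ∃ t ∈ T, ∃ γ, m = t + γ := by
  classical
  obtain ⟨G, hG⟩ := hΓ
  have hGΓ : ∀ g : G, (g : M) ∈ Γ := fun g => by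
    rw [← hG]; exact AddSubmonoid.subset_closure g.2
  let φ : (G → ℕ) →+ Γ :=
    { toFun := fun a => ∑ g, a g • (⟨g, hGΓ g⟩ : Γ)
      map_zero' := by simp
      map_add' := fun a b => by
        simp only [Pi.add_apply, add_smul]
        exact Finset.sum_add_distrib }
  have hsurj : ∀ x : Γ, ∃ a, φ a = x := by
    have hle : Γ ≤ AddMonoidHom.mrange (Γ.subtype.comp φ) := by
      conv_lhs => rw [← hG]
      rw [AddSubmonoid.closure_le]
      intro g hg
      refine ⟨Pi.single ⟨g, hg⟩ 1, ?_⟩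
      have : φ (Pi.single ⟨g, hg⟩ 1) = ⟨g, hGΓ ⟨g, hg⟩⟩ := by
        show ∑ t, (Pi.single _ 1 : G → ℕ) t • _ = _
        rw [Finset.sum_eq_single ⟨g, hg⟩]
        · simp
        · intro b _ hb; rw [Pi.single_eq_of_ne hb, zero_smul]
        · intro h; exact absurd (Finset.mem_univ _) h
      rw [AddMonoidHom.comp_apply, this]
      rfl
    intro x
    obtain ⟨a, ha⟩ := hle x.2
    exact ⟨a, Subtype.ext ha⟩
  have hfin : {a | Minimal (fun a => φ a ∈ S) a}.Finite :=
    WellQuasiOrderedLE.finite_of_isAntichain (setOfPred_minimal_antichain _)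
  refine ⟨hfin.toFinset.image φ, ?_, ?_⟩
  · intro x hx
    obtain ⟨a, ha, rfl⟩ := Finset.mem_image.1 hx
    exact Minimal.prop (P := fun a => φ a ∈ S) (hfin.mem_toFinset.1 ha)
  · intro m hm
    obtain ⟨a, rfl⟩ := hsurj m
    obtain ⟨b, hb, hmin⟩ := exists_minimal_le_of_wellFoundedLT (fun a => φ a ∈ S) a hm
    refine ⟨φ b, Finset.mem_image_of_mem _ (hfin.mem_toFinset.2 hmin), φ (a - b), ?_⟩
    rw [← map_add, add_tsub_cancel_of_le hb]

/-- The elements of `S` of minimal weight. -/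
def minimizers {Γ : AddSubmonoid M} (w : NR M) (S : Set Γ) : Set Γ :=
  {m | m ∈ S ∧ ∀ m' ∈ S, weight w m ≤ weight w m'}

/-- By Dickson's lemma `S` lies in `T + Γ` with `T ⊆ S` finite, and `w` is nonnegative on `Γ`; so
the minimum over `T` is the minimum over `S`, although the weights on `Γ` need not be discrete. -/
theorem minimizers_nonempty {Γ : AddSubmonoid M} (hΓ : Γ.FG) {w : NR M} (hw : w ∈ cone Γ)
    {S : Set Γ} (hS : S.Nonempty) : (minimizers w S).Nonempty := by
  obtain ⟨T, hTS, hT⟩ := exists_finset_subset_add hΓ S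
  obtain ⟨m, hm⟩ := hS
  obtain ⟨t, ht, -⟩ := hT m hm
  obtain ⟨t₀, ht₀, hmin⟩ := T.exists_min_image (fun t => weight w (t : M)) ⟨t, ht⟩
  refine ⟨t₀, hTS ht₀, fun m' hm' => ?_⟩
  obtain ⟨t', ht', γ, rfl⟩ := hT m' hm'
  rw [AddSubmonoid.coe_add, map_add]
  exact (hmin t' ht').trans (le_add_of_nonneg_right (weight_nonneg hw γ.2))

/-- Adding a nonzero element of `Γ` strictly increases a positive functional, so its minimizers are
among the generators given by Dickson's lemma. For a weight that is only nonnegative there can be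
infinitely many minimizers. -/
theorem mem_of_mem_minimizers {Γ : AddSubmonoid M} {l : NR M} (hl : IsPositive Γ l)
    {S T : Set Γ} (hTS : T ⊆ S) (hT : ∀ m ∈ S, ∃ t ∈ T, ∃ γ, m = t + γ) {m : Γ}
    (hm : m ∈ minimizers l S) : m ∈ T := by
  obtain ⟨t, ht, γ, rfl⟩ := hT m hm.1
  have h := hm.2 t (hTS ht)
  rw [AddSubmonoid.coe_add, map_add] at h
  by_cases h0 : γ = 0
  · rwa [h0, add_zero]
  · have := hl γ γ.2 fun h => h0 (Subtype.ext h)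
    linarith

theorem finite_minimizers {Γ : AddSubmonoid M} (hΓ : Γ.FG) {l : NR M} (hl : IsPositive Γ l)
    (S : Set Γ) : (minimizers l S).Finite := by
  obtain ⟨T, hTS, hT⟩ := exists_finset_subset_add hΓ S
  exact T.finite_toSet.subset fun m hm => mem_of_mem_minimizers hl hTS hT hm

/-- Faces of a semigroup. -/
structure IsMonoidFace (Γ' Γ : AddSubmonoid M) : Prop where
  le : Γ' ≤ Γ
  mem_left : ∀ a ∈ Γ, ∀ b ∈ Γ, a + b ∈ Γ' → a ∈ Γ'

theorem IsMonoidFace.mem_right {Γ' Γ : AddSubmonoid M} (h : IsMonoidFace Γ' Γ) {a b : M}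
    (ha : a ∈ Γ) (hb : b ∈ Γ) (hab : a + b ∈ Γ') : b ∈ Γ' :=
  h.mem_left b hb a ha (by rwa [add_comm])

theorem IsMonoidFace.exists_generators {Γ' Γ : AddSubmonoid M} (h : IsMonoidFace Γ' Γ)
    {S : Set M} (hS : AddSubmonoid.closure S = Γ) :
    AddSubmonoid.closure (S ∩ Γ') = Γ' := by
  have hSΓ : ∀ x ∈ AddSubmonoid.closure S, x ∈ Γ := fun x hx => by rwa [hS] at hx
  refine le_antisymm (AddSubmonoid.closure_le.2 Set.inter_subset_right) fun m hm => ?_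
  have hmΓ := h.le hm
  rw [← hS] at hmΓ
  refine AddSubmonoid.closure_induction
    (motive := fun m _ => m ∈ Γ' → m ∈ AddSubmonoid.closure (S ∩ Γ')) ?_ ?_ ?_ hmΓ hm
  · exact fun x hx hx' => AddSubmonoid.subset_closure ⟨hx, hx'⟩
  · exact fun _ => zero_mem _
  · intro a b ha hb iha ihb hab
    exact add_mem (iha (h.mem_left a (hSΓ a ha) b (hSΓ b hb) hab))
      (ihb (h.mem_right (hSΓ a ha) (hSΓ b hb) hab))

theorem IsMonoidFace.pointedAffine {Γ' Γ : AddSubmonoid M} [hΓ : PointedAffine Γ]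
    (h : IsMonoidFace Γ' Γ) : PointedAffine Γ' where
  fg := by
    classical
    obtain ⟨S, hS⟩ := hΓ.fg
    refine (AddSubmonoid.fg_iff _).2 ⟨S ∩ Γ', h.exists_generators hS,
      S.finite_toSet.subset Set.inter_subset_left⟩
  pointed m hm hm' := hΓ.pointed m (h.le hm) (h.le hm')

/-- Every face of a finitely generated semigroup is the zero set of an element of the dual
cone. -/
theorem IsMonoidFace.exists_weight_eq_zero_iff [Module.Free ℤ M] [Module.Finite ℤ M]
    {Γ' Γ : AddSubmonoid M} (h : IsMonoidFace Γ' Γ) (hΓ : Γ.FG) :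
    ∃ u ∈ cone Γ, ∀ m ∈ Γ, weight u m = 0 ↔ m ∈ Γ' := by
  classical
  have hΓ' : Γ'.FG := by
    obtain ⟨S, hS⟩ := hΓ
    exact (AddSubmonoid.fg_iff _).2 ⟨S ∩ Γ', h.exists_generators hS,
      S.finite_toSet.subset Set.inter_subset_left⟩
  -- The dual cone of `Γ''` consists of the functionals that are nonnegative on `Γ` and vanish on
  -- `Γ'`.
  let Γ'' : AddSubmonoid M := Γ ⊔ Γ'.map (-AddMonoidHom.id M)
  have hΓ'' : Γ''.FG := hΓ.sup (hΓ'.map _)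
  have hsingle : ∀ m ∈ Γ, m ∉ Γ' → ∃ u ∈ cone Γ, (∀ m ∈ Γ', weight u m = 0) ∧ 0 < weight u m := by
    intro m hm hm'
    by_contra! hcon
    -- If no such functional is positive at `m`, Farkas' lemma applies to `-m`. Then `n • m + a = b`
    -- with `a ∈ Γ`, `b ∈ Γ'` and `n > 0`, and the face property forces `m ∈ Γ'`.
    have hsat : -m ∈ sat Γ'' := by
      refine mem_sat_of_forall_cone hΓ'' fun u hu => ?_
      have hu' : ∀ x ∈ Γ'', 0 ≤ weight u x := mem_cone_iff.1 hu
      have hle : Γ ≤ Γ'' := le_sup_left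
      have huΓ : u ∈ cone Γ := mem_cone_iff.2 fun x hx => hu' x (hle hx)
      have := hcon u huΓ fun x hx => le_antisymm ?_ (hu' x (hle (h.le hx)))
      · rw [← weight_apply, map_neg]; linarith
      · have := hu' (-x) (le_sup_right (α := AddSubmonoid M) ⟨x, hx, rfl⟩)
        rw [map_neg] at this; linarith
    obtain ⟨n, hn, hmem⟩ := hsat
    obtain ⟨a, ha, _, ⟨b, hb, rfl⟩, hab⟩ := AddSubmonoid.mem_sup.1 hmem
    obtain ⟨n, rfl⟩ := Nat.exists_eq_succ_of_ne_zero hn.ne'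
    refine hm' (h.mem_left m hm (n • m + a) (add_mem (nsmul_mem hm n) ha) ?_)
    have : m + (n • m + a) = b := by
      have hab' : a + -b = (n + 1) • -m := hab
      rw [smul_neg, succ_nsmul, ← sub_eq_add_neg, sub_eq_iff_eq_add] at hab'
      rw [hab']; abel
    rwa [this]
  obtain ⟨S, hS⟩ := hΓ
  have hSΓ : ∀ s ∈ S, s ∈ Γ := fun s hs => by rw [← hS]; exact AddSubmonoid.subset_closure hs
  choose! u hu huz hup using hsingle
  -- Summing over the generators outside `Γ'` gives one functional positive at all of them.
  let U : NR M := ∑ s ∈ S.filter (· ∉ Γ'), u s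
  have hU : ∀ m, weight U m = ∑ s ∈ S.filter (· ∉ Γ'), weight (u s) m := fun m => by
    simp only [weight_apply, U, LinearMap.sum_apply]
  have hmem : ∀ s ∈ S.filter (· ∉ Γ'), s ∈ Γ ∧ s ∉ Γ' := fun s hs =>
    ⟨hSΓ s (Finset.mem_filter.1 hs).1, (Finset.mem_filter.1 hs).2⟩
  have hUcone : ∀ m ∈ Γ, 0 ≤ weight U m := fun m hm => by
    rw [hU]
    exact Finset.sum_nonneg fun s hs => weight_nonneg (hu s (hmem s hs).1 (hmem s hs).2) hm
  refine ⟨U, mem_cone_iff.2 hUcone, fun m hm => ⟨fun h0 => ?_, fun hm' => ?_⟩⟩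
  · have : ∀ m ∈ AddSubmonoid.closure (S : Set M), m ∈ Γ ∧ (m ∈ Γ' ∨ 0 < weight U m) := by
      intro m hm
      refine AddSubmonoid.closure_induction
        (motive := fun m _ => m ∈ Γ ∧ (m ∈ Γ' ∨ 0 < weight U m)) ?_ ?_ ?_ hm
      · intro s hs
        refine ⟨hSΓ s hs, or_iff_not_imp_left.2 fun hs' => ?_⟩
        rw [hU]
        exact Finset.sum_pos' (fun t ht =>
          weight_nonneg (hu t (hmem t ht).1 (hmem t ht).2) (hSΓ s hs))
          ⟨s, Finset.mem_filter.2 ⟨hs, hs'⟩, hup s (hSΓ s hs) hs'⟩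
      · exact ⟨zero_mem _, Or.inl (zero_mem _)⟩
      · rintro a b - - ⟨ha, ha'⟩ ⟨hb, hb'⟩
        refine ⟨add_mem ha hb, ?_⟩
        rw [map_add]
        rcases ha' with ha' | ha'
        · rcases hb' with hb' | hb'
          · exact Or.inl (add_mem ha' hb')
          · exact Or.inr (add_pos_of_nonneg_of_pos (hUcone a ha) hb')
        · exact Or.inr (add_pos_of_pos_of_nonneg ha' (hUcone b hb))
    rw [hS] at this
    exact (this m hm).2.resolve_right h0.not_gt
  · rw [hU]
    exact Finset.sum_eq_zero fun s hs => huz s (hmem s hs).1 (hmem s hs).2 m hm'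

/-- Pointedness says that `{0}` is a face of `Γ`; an element of the dual cone cutting it out is
positive elsewhere. -/
theorem exists_isPositive [Module.Free ℤ M] [Module.Finite ℤ M] (Γ : AddSubmonoid M)
    [hΓ : PointedAffine Γ] : ∃ l, IsPositive Γ l := by
  have hface : IsMonoidFace ⊥ Γ := by
    refine ⟨bot_le, fun a ha b hb hab => ?_⟩
    rw [AddSubmonoid.mem_bot] at hab ⊢
    exact hΓ.pointed a ha (by rwa [neg_eq_of_add_eq_zero_right hab])
  obtain ⟨u, hu, hu0⟩ := hface.exists_weight_eq_zero_iff hΓ.fg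
  refine ⟨u, fun m hm h0 => lt_of_le_of_ne (weight_nonneg hu hm) fun h => h0 ?_⟩
  exact AddSubmonoid.mem_bot.1 ((hu0 m hm).1 h.symm)

end Semigroups

/-! ### Rings of power series -/

section SeriesRings

variable {M : Type*} [AddCommGroup M] {Γ Δ : AddSubmonoid M} {K : Type*} [Field K]

namespace Series

/-- The set of exponents of the monomials of a series. -/
def supp (f : Series Γ K) : Set Γ := {m | f.coeff m ≠ 0}

theorem mem_supp {f : Series Γ K} {m : Γ} : m ∈ f.supp ↔ f.coeff m ≠ 0 := Iff.rfl

@[simp] theorem coeff_neg (f : Series Γ K) (m : Γ) : (-f).coeff m = -f.coeff m := rfl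

@[simp] theorem coeff_sub (f g : Series Γ K) (m : Γ) : (f - g).coeff m = f.coeff m - g.coeff m :=
  rfl

theorem supp_nonempty {f : Series Γ K} (hf : f ≠ 0) : f.supp.Nonempty := by
  by_contra h
  rw [Set.not_nonempty_iff_eq_empty] at h
  exact hf (ext fun m => by_contra fun hm => (h ▸ hm : m ∈ (∅ : Set Γ)))

theorem supp_add {f g : Series Γ K} {m : Γ} (hm : m ∈ (f + g).supp) :
    m ∈ f.supp ∨ m ∈ g.supp := by
  by_contra! h
  simp only [mem_supp, not_not] at h
  refine hm ?_
  show f.coeff m + g.coeff m = 0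
  rw [h.1, h.2, add_zero]

variable [PointedAffine Γ] [PointedAffine Δ]

theorem supp_mul {f g : Series Γ K} {m : Γ} (hm : m ∈ (f * g).supp) :
    ∃ a ∈ f.supp, ∃ b ∈ g.supp, a + b = m := by
  obtain ⟨p, hp, hne⟩ := Finset.exists_ne_zero_of_sum_ne_zero hm
  exact ⟨p.1, left_ne_zero_of_mul hne, p.2, right_ne_zero_of_mul hne,
    Finset.HasAntidiagonal.mem_antidiagonal.1 hp⟩

theorem coeff_one (m : Γ) [Decidable (m = 0)] :
    (1 : Series Γ K).coeff m = if m = 0 then 1 else 0 := by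
  show (monomial K 0).coeff m = _
  rw [coeff_monomial]
  congr

theorem monomial_zero : monomial K (0 : Γ) = 1 := rfl

theorem mem_supp_monomial {m k : Γ} : k ∈ (monomial K m).supp ↔ k = m := by
  rw [mem_supp, coeff_monomial]
  split_ifs with h <;> simp [h]

theorem supp_monomial_mul {m k : Γ} {f : Series Γ K} (hk : k ∈ (monomial K m * f).supp) :
    ∃ b ∈ f.supp, k = m + b := by
  obtain ⟨a, ha, b, hb, rfl⟩ := supp_mul hk
  rw [mem_supp_monomial] at ha
  exact ⟨b, hb, by rw [ha]⟩

/-- A series with a nonzero constant term is invertible. -/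
theorem isUnit_of_coeff_zero_ne_zero {f : Series Γ K} (hf : f.coeff 0 ≠ 0) : IsUnit f := by
  classical
  -- The inverse is built by recursion on proper summands. This is well founded because the number
  -- of decompositions grows strictly: adding `a` to the first term embeds those of `b` into those
  -- of `a + b`, and misses `(0, a + b)` by pointedness.
  let r : Γ → Γ → Prop := fun b m => ∃ a, a ≠ 0 ∧ a + b = m
  have hwf : WellFounded r := by
    refine Subrelation.wf (r := (measure fun m : Γ =>
      (Finset.HasAntidiagonal.antidiagonal m).card).rel) ?_ (measure _).wf
    rintro b _ ⟨a, ha, rfl⟩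
    show (Finset.HasAntidiagonal.antidiagonal b).card <
      (Finset.HasAntidiagonal.antidiagonal (a + b)).card
    have hsub : (Finset.HasAntidiagonal.antidiagonal b).image (fun p => (a + p.1, p.2)) ⊂
        Finset.HasAntidiagonal.antidiagonal (a + b) := by
      refine Finset.ssubset_iff.2 ⟨(0, a + b), fun h => ?_, ?_⟩
      · obtain ⟨p, -, hp⟩ := Finset.mem_image.1 h
        have h1 : (a : M) + (p.1 : M) = 0 := by
          have := congrArg Prod.fst hp
          exact congrArg Subtype.val this
        refine ha (Subtype.ext (PointedAffine.pointed (a : M) a.2 ?_))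
        rw [neg_eq_of_add_eq_zero_right h1]
        exact p.1.2
      · intro q hq
        rcases Finset.mem_insert.1 hq with rfl | hq
        · simp
        · obtain ⟨p, hp, rfl⟩ := Finset.mem_image.1 hq
          rw [Finset.HasAntidiagonal.mem_antidiagonal] at hp ⊢
          rw [← hp, add_assoc]
    have := Finset.card_lt_card hsub
    rwa [Finset.card_image_of_injective] at this
    rintro ⟨x, y⟩ ⟨x', y'⟩ h
    simpa using h
  let F : (m : Γ) → ((b : Γ) → r b m → K) → K := fun m ih =>
    (f.coeff 0)⁻¹ * ((1 : Series Γ K).coeff m -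
      ∑ p ∈ (Finset.HasAntidiagonal.antidiagonal m).attach,
        if h : p.1.1 ≠ 0 then
          f.coeff p.1.1 * ih p.1.2 ⟨p.1.1, h, Finset.HasAntidiagonal.mem_antidiagonal.1 p.2⟩
        else 0)
  let g : Series Γ K := hwf.fix F
  have hg : ∀ m, g.coeff m = (f.coeff 0)⁻¹ * ((1 : Series Γ K).coeff m -
      ∑ p ∈ Finset.HasAntidiagonal.antidiagonal m,
        if p.1 ≠ 0 then f.coeff p.1 * g.coeff p.2 else 0) := by
    intro m
    show hwf.fix F m = _
    rw [hwf.fix_eq]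
    rw [← Finset.sum_attach]
    simp only [F, dite_eq_ite]
    rfl
  refine IsUnit.of_mul_eq_one g (ext fun m => ?_)
  have h0 : ((0, m) : Γ × Γ) ∈ Finset.HasAntidiagonal.antidiagonal m := by simp
  rw [coeff_mul, ← Finset.add_sum_erase _ _ h0]
  have h1 := hg m
  rw [← Finset.add_sum_erase _ _ h0] at h1
  have h2 : ∑ p ∈ (Finset.HasAntidiagonal.antidiagonal m).erase (0, m),
      (if p.1 ≠ 0 then f.coeff p.1 * g.coeff p.2 else 0) =
      ∑ p ∈ (Finset.HasAntidiagonal.antidiagonal m).erase (0, m), f.coeff p.1 * g.coeff p.2 := by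
    refine Finset.sum_congr rfl fun p hp => if_pos fun hp0 => ?_
    obtain ⟨hne, hp⟩ := Finset.mem_erase.1 hp
    rw [Finset.HasAntidiagonal.mem_antidiagonal, hp0, zero_add] at hp
    exact hne (Prod.ext hp0 hp)
  rw [h2] at h1
  simp only [ne_eq, not_true_eq_false, if_false, zero_add] at h1
  rw [h1, mul_inv_cancel_left₀ hf]
  ring

open Classical in
/-- The extension by zero of a series, as a series with exponents in `Δ ⊇ Γ`. -/
def extendZero (Δ : AddSubmonoid M) (f : Series Γ K) : Series Δ K :=
  fun m => if hm : (m : M) ∈ Γ then f.coeff ⟨m, hm⟩ else 0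

theorem coeff_extendZero {f : Series Γ K} {m : Δ} (hm : (m : M) ∈ Γ) :
    (extendZero Δ f).coeff m = f.coeff ⟨m, hm⟩ := dif_pos hm

theorem coeff_extendZero_of_notMem {f : Series Γ K} {m : Δ} (hm : (m : M) ∉ Γ) :
    (extendZero Δ f).coeff m = 0 := dif_neg hm

/-- The inclusion of `K[[Γ]]` into `K[[Δ]]`, where `Γ ⊆ Δ`. -/
def inclusion (K : Type*) [Field K] (h : Γ ≤ Δ) : Series Γ K →+* Series Δ K where
  toFun := extendZero Δ
  map_zero' := by
    ext m
    by_cases hm : (m : M) ∈ Γ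
    · rw [coeff_extendZero hm, coeff_zero, coeff_zero]
    · rw [coeff_extendZero_of_notMem hm, coeff_zero]
  map_one' := by
    classical
    ext m
    by_cases hm : (m : M) ∈ Γ
    · rw [coeff_extendZero hm, coeff_one, coeff_one]
      exact if_congr (by rw [Subtype.ext_iff, Subtype.ext_iff]; rfl) rfl rfl
    · rw [coeff_extendZero_of_notMem hm, coeff_one, if_neg]
      rintro rfl
      exact hm Γ.zero_mem
  map_add' f g := by
    ext m
    rw [coeff_add]
    by_cases hm : (m : M) ∈ Γ
    · simp only [coeff_extendZero hm, coeff_add]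
    · simp only [coeff_extendZero_of_notMem hm, add_zero]
  map_mul' f g := by
    ext m
    rw [coeff_mul]
    by_cases hm : (m : M) ∈ Γ
    · rw [coeff_extendZero hm, coeff_mul]
      refine Finset.sum_of_injOn
        (fun p => (AddSubmonoid.inclusion h p.1, AddSubmonoid.inclusion h p.2)) ?_ ?_ ?_ ?_
      · rintro ⟨a, b⟩ _ ⟨a', b'⟩ _ hab
        simp only [Prod.mk.injEq] at hab
        exact Prod.ext (AddSubmonoid.inclusion_injective h hab.1)
          (AddSubmonoid.inclusion_injective h hab.2)
      · intro p hp
        simp only [Finset.mem_coe, Finset.HasAntidiagonal.mem_antidiagonal] at hp ⊢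
        have hp' := congrArg (Subtype.val : Γ → M) hp
        exact Subtype.ext hp'
      · rintro ⟨a, b⟩ hab hnot
        rw [Finset.HasAntidiagonal.mem_antidiagonal] at hab
        by_cases ha : (a : M) ∈ Γ
        · by_cases hb : (b : M) ∈ Γ
          · refine absurd ⟨(⟨a, ha⟩, ⟨b, hb⟩), ?_, rfl⟩ hnot
            simp only [Finset.mem_coe, Finset.HasAntidiagonal.mem_antidiagonal]
            have hab' := congrArg (Subtype.val : Δ → M) hab
            exact Subtype.ext hab'
          · rw [coeff_extendZero_of_notMem hb, mul_zero]
        · rw [coeff_extendZero_of_notMem ha, zero_mul]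
      · rintro ⟨a, b⟩ _
        rw [coeff_extendZero (m := AddSubmonoid.inclusion h a) a.2,
          coeff_extendZero (m := AddSubmonoid.inclusion h b) b.2]
        rfl
    · rw [coeff_extendZero_of_notMem hm, eq_comm]
      refine Finset.sum_eq_zero ?_
      rintro ⟨a, b⟩ hab
      rw [Finset.HasAntidiagonal.mem_antidiagonal] at hab
      by_cases ha : (a : M) ∈ Γ
      · by_cases hb : (b : M) ∈ Γ
        · refine absurd ?_ hm
          rw [← hab]
          exact Γ.add_mem ha hb
        · rw [coeff_extendZero_of_notMem hb, mul_zero]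
      · rw [coeff_extendZero_of_notMem ha, zero_mul]

theorem coeff_inclusion (h : Γ ≤ Δ) (f : Series Γ K) {m : M} (hm : m ∈ Γ) :
    (inclusion K h f).coeff ⟨m, h hm⟩ = f.coeff ⟨m, hm⟩ := coeff_extendZero (m := ⟨m, h hm⟩) hm

theorem coeff_inclusion_of_notMem (h : Γ ≤ Δ) (f : Series Γ K) {m : Δ} (hm : (m : M) ∉ Γ) :
    (inclusion K h f).coeff m = 0 := coeff_extendZero_of_notMem hm

theorem inclusion_injective (h : Γ ≤ Δ) : Function.Injective (inclusion K h) := by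
  intro f g hfg
  ext ⟨m, hm⟩
  rw [← coeff_inclusion h f hm, hfg, coeff_inclusion]

theorem inclusion_monomial (h : Γ ≤ Δ) (m : Γ) :
    inclusion K h (monomial K m) = monomial K (⟨m, h m.2⟩ : Δ) := by
  classical
  ext ⟨k, hk⟩
  by_cases hkΓ : k ∈ Γ
  · rw [coeff_inclusion h _ hkΓ, coeff_monomial, coeff_monomial]
    exact if_congr (by rw [Subtype.ext_iff, Subtype.ext_iff]) rfl rfl
  · rw [coeff_inclusion_of_notMem h _ hkΓ, coeff_monomial, if_neg]
    rintro h'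
    rw [Subtype.ext_iff] at h'
    exact hkΓ (by rw [show k = m from h']; exact m.2)

/-- The restriction of a series to the exponents in `Γ ⊆ Δ`. -/
def restrictTo (h : Γ ≤ Δ) (f : Series Δ K) : Series Γ K := fun m => f.coeff ⟨m, h m.2⟩

theorem coeff_restrictTo (h : Γ ≤ Δ) (f : Series Δ K) (m : Γ) :
    (restrictTo h f).coeff m = f.coeff ⟨m, h m.2⟩ := rfl

/-- The restriction of series to the exponents in a face, as a ring morphism. -/
def restrictFace (K : Type*) [Field K] (h : IsMonoidFace Γ Δ) : Series Δ K →+* Series Γ K where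
  toFun := restrictTo h.le
  map_zero' := rfl
  map_add' _ _ := rfl
  map_one' := by
    classical
    ext m
    rw [coeff_restrictTo, coeff_one, coeff_one]
    exact if_congr (by rw [Subtype.ext_iff, Subtype.ext_iff]; rfl) rfl rfl
  map_mul' f g := by
    ext m
    rw [coeff_restrictTo, coeff_mul, coeff_mul, eq_comm]
    refine Finset.sum_of_injOn
      (fun p => (AddSubmonoid.inclusion h.le p.1, AddSubmonoid.inclusion h.le p.2)) ?_ ?_ ?_ ?_
    · rintro ⟨a, b⟩ _ ⟨a', b'⟩ _ hab
      simp only [Prod.mk.injEq] at hab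
      exact Prod.ext (AddSubmonoid.inclusion_injective h.le hab.1)
        (AddSubmonoid.inclusion_injective h.le hab.2)
    · intro p hp
      simp only [Finset.mem_coe, Finset.HasAntidiagonal.mem_antidiagonal] at hp ⊢
      have hp' := congrArg (Subtype.val : Γ → M) hp
      exact Subtype.ext hp'
    · rintro ⟨a, b⟩ hab hnot
      rw [Finset.HasAntidiagonal.mem_antidiagonal] at hab
      have hab' : (a : M) + b = m := congrArg Subtype.val hab
      have habΓ : (a : M) + b ∈ Γ := hab' ▸ m.2
      refine absurd ⟨(⟨a, h.mem_left a a.2 b b.2 habΓ⟩, ⟨b, h.mem_right a.2 b.2 habΓ⟩), ?_, rfl⟩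
        hnot
      simp only [Finset.mem_coe, Finset.HasAntidiagonal.mem_antidiagonal]
      exact Subtype.ext hab'
    · rintro ⟨a, b⟩ _
      rfl

theorem coeff_restrictFace (h : IsMonoidFace Γ Δ) (f : Series Δ K) (m : Γ) :
    (restrictFace K h f).coeff m = f.coeff ⟨m, h.le m.2⟩ := rfl

theorem restrictFace_monomial_of_mem (h : IsMonoidFace Γ Δ) {m : M} (hm : m ∈ Γ) :
    restrictFace K h (monomial K ⟨m, h.le hm⟩) = monomial K ⟨m, hm⟩ := by
  classical
  ext k
  rw [coeff_restrictFace, coeff_monomial, coeff_monomial]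
  exact if_congr (by rw [Subtype.ext_iff, Subtype.ext_iff]) rfl rfl

theorem restrictFace_monomial_of_notMem (h : IsMonoidFace Γ Δ) {m : Δ} (hm : (m : M) ∉ Γ) :
    restrictFace K h (monomial K m) = 0 := by
  ext k
  rw [coeff_restrictFace, coeff_monomial, coeff_zero, if_neg]
  rintro rfl
  exact hm k.2

/-- Splitting off `χ^t h` for one `t` at a time writes `g` as a finite sum of such products. As `v h
≥ 0`, the ultrametric inequality for finite sums is enough, and no continuity of `v` enters. -/
theorem le_val_of_forall_finset {v : RealVal (Series Γ K)} (hv : ∀ g, 0 ≤ v g) {c : WithTop ℝ}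
    (T : Finset Γ) (hT : ∀ t ∈ T, c ≤ v (monomial K t)) :
    ∀ g : Series Γ K, (∀ m ∈ g.supp, ∃ t ∈ T, ∃ γ, m = t + γ) → c ≤ v g := by
  classical
  induction T using Finset.induction_on with
  | empty =>
    intro g hg
    have : g = 0 := by
      by_contra h
      obtain ⟨m, hm⟩ := supp_nonempty h
      simpa using hg m hm
    rw [this, v.map_zero]
    exact le_top
  | insert t T ht ih =>
    intro g hg
    let h : Series Γ K := fun γ => g.coeff (t + γ)
    have h1 : c ≤ v (monomial K t * h) := by
      rw [v.map_mul]
      exact (hT t (Finset.mem_insert_self _ _)).trans (le_add_of_nonneg_right (hv h))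
    have h2 : c ≤ v (g - monomial K t * h) := by
      refine ih (fun t ht => hT t (Finset.mem_insert_of_mem ht)) _ fun m hm => ?_
      -- After the subtraction no exponent is left in `t + Γ`, so the remaining ones are covered by
      -- the smaller set `T`.
      have hne : ∀ γ, m ≠ t + γ := by
        rintro γ rfl
        refine hm ?_
        rw [coeff_sub, monomial_mul_coeff_add]
        exact sub_self _
      have hmg : m ∈ g.supp := by
        rw [mem_supp, coeff_sub] at hm
        by_contra hmg
        rw [mem_supp, not_not] at hmg
        rw [hmg, zero_sub, neg_ne_zero] at hm
        obtain ⟨b, -, hb⟩ := supp_monomial_mul hm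
        exact hne b hb
      obtain ⟨s, hs, γ, hγ⟩ := hg m hmg
      rcases Finset.mem_insert.1 hs with rfl | hs
      · exact absurd hγ (hne γ)
      · exact ⟨s, hs, γ, hγ⟩
    have := v.map_add (g - monomial K t * h) (monomial K t * h)
    rw [sub_add_cancel] at this
    exact (le_min h2 h1).trans this

/-- A nonnegative valuation of a series is at least the infimum of the valuations of its
monomials. -/
theorem le_val {v : RealVal (Series Γ K)} (hv : ∀ g, 0 ≤ v g) {c : WithTop ℝ} {g : Series Γ K}
    (hg : ∀ m ∈ g.supp, c ≤ v (monomial K m)) : c ≤ v g := by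
  obtain ⟨T, hTS, hT⟩ := exists_finset_subset_add (PointedAffine.fg (Γ := Γ)) g.supp
  exact le_val_of_forall_finset hv T (fun t ht => hg t (hTS ht)) g hT

/-- A strict form of `le_val`. -/
theorem lt_val {v : RealVal (Series Γ K)} (hv : ∀ g, 0 ≤ v g) {c : WithTop ℝ} (hc : c ≠ ⊤)
    {g : Series Γ K} (hg : ∀ m ∈ g.supp, c < v (monomial K m)) : c < v g := by
  classical
  obtain ⟨T, hTS, hT⟩ := exists_finset_subset_add (PointedAffine.fg (Γ := Γ)) g.supp
  -- The inequality stays strict because `T` is finite; `c ≠ ⊤` covers the empty `T`, whose infimum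
  -- is `⊤`.
  have hlt : c < T.inf fun t => v (monomial K t) :=
    (Finset.lt_inf_iff (lt_top_iff_ne_top.2 hc)).2 fun t ht => hg t (hTS ht)
  exact hlt.trans_le (le_val_of_forall_finset hv T
    (fun t ht => Finset.inf_le (f := fun t => v (monomial K t)) ht) g hT)

end Series

end SeriesRings

/-! ### Newton cones in terms of minimal exponents -/

section NewtonCones

variable {M : Type*} [AddCommGroup M] {Γ : AddSubmonoid M} {K : Type*} [Field K]

theorem mem_minimizers_of_weight_le {w : NR M} {S : Set Γ} {m m' : Γ} (hm : m ∈ minimizers w S)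
    (hm' : m' ∈ S) (h : weight w m' ≤ weight w m) : m' ∈ minimizers w S :=
  ⟨hm', fun x hx => h.trans (hm.2 x hx)⟩

theorem weight_eq_of_mem_minimizers {w : NR M} {S : Set Γ} {m m' : Γ} (hm : m ∈ minimizers w S)
    (hm' : m' ∈ minimizers w S) : weight w m = weight w m' :=
  le_antisymm (hm.2 m' hm'.1) (hm'.2 m hm.1)

/-- A small perturbation of a weight does not make minimal an element which was not. -/
theorem exists_perturbation (hΓ : Γ.FG) {w l : NR M} (hw : w ∈ cone Γ) (hl : l ∈ cone Γ)
    {S : Set Γ} {m₀ : Γ} (hm₀ : m₀ ∈ minimizers w S) :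
    ∃ ε : ℝ, 0 < ε ∧ ∀ m ∈ S, m ∉ minimizers w S →
      weight (w + ε • l) m₀ < weight (w + ε • l) m := by
  by_cases hne : (S \ minimizers w S).Nonempty
  · obtain ⟨m₁, hm₁, hmin⟩ := minimizers_nonempty hΓ hw hne
    have hgap : weight w m₀ < weight w m₁ := by
      by_contra! h
      exact hm₁.2 (mem_minimizers_of_weight_le hm₀ hm₁.1 h)
    have hl₀ : 0 ≤ weight l m₀ := weight_nonneg hl m₀.2
    have hpos : 0 < weight l m₀ + 1 := by linarith
    -- The weights outside the minimizers have a least value, hence a gap above the minimum. This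
    -- `ε` keeps `ε * weight l m₀` below the gap; the `+ 1` avoids a zero denominator.
    refine ⟨(weight w m₁ - weight w m₀) / (weight l m₀ + 1),
      div_pos (sub_pos.2 hgap) hpos, fun m hm hm' => ?_⟩
    have h1 : (weight w m₁ - weight w m₀) / (weight l m₀ + 1) * weight l m₀ <
        weight w m₁ - weight w m₀ := by
      rw [div_mul_eq_mul_div, div_lt_iff₀ hpos]
      exact mul_lt_mul_of_pos_left (by linarith) (sub_pos.2 hgap)
    have h2 : 0 ≤ (weight w m₁ - weight w m₀) / (weight l m₀ + 1) * weight l m :=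
      mul_nonneg (div_pos (sub_pos.2 hgap) hpos).le (weight_nonneg hl m.2)
    have h3 := hmin m ⟨hm, hm'⟩
    simp only [weight_add, weight_smul]
    linarith
  · refine ⟨1, one_pos, fun m hm hm' => absurd ⟨m, hm, hm'⟩ hne⟩

theorem toMR_injective [Module.Free ℤ M] [Module.Finite ℤ M] :
    Function.Injective (toMR : M → MR M) := by
  intro a b hab
  by_contra hne
  obtain ⟨u, hu⟩ := functional_separates (sub_ne_zero.2 hne)
  rw [toMR_sub, hab, sub_self, map_zero] at hu
  exact hu rfl

theorem IsPositive.eq_zero_or_pos {l : NR M} (hl : IsPositive Γ l) {x : MR M}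
    (hx : x ∈ dualCone Γ) : x = 0 ∨ 0 < l x := by
  refine Submodule.span_induction (p := fun x _ => x = 0 ∨ 0 < l x) ?_ ?_ ?_ ?_ hx
  · rintro _ ⟨m, hm, rfl⟩
    by_cases h : m = 0
    · exact Or.inl (by rw [h, toMR_zero])
    · exact Or.inr (hl m hm h)
  · exact Or.inl rfl
  · rintro x y - - (rfl | hx) (rfl | hy)
    · simp
    · simp [hy]
    · simp [hx]
    · exact Or.inr (by rw [map_add]; exact add_pos hx hy)
  · rintro ⟨a, ha⟩ x - (rfl | hx)
    · simp
    · show a • x = 0 ∨ 0 < l (a • x)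
      rcases (show (0 : ℝ) ≤ a from ha).eq_or_lt with rfl | ha
      · simp
      · rw [map_smul]
        exact Or.inr (mul_pos ha hx)

theorem convex_newtonPlus (f : Series Γ K) : Convex ℝ (newtonPlus f) := convex_convexHull _ _

theorem toMR_mem_newtonPlus {f : Series Γ K} {m : Γ} (hm : m ∈ f.supp) :
    toMR (m : M) ∈ newtonPlus f := by
  refine subset_convexHull _ _ (Set.mem_iUnion.2 ⟨⟨m, hm⟩, 0, ?_, ?_⟩)
  · exact Submodule.zero_mem _
  · simp

theorem newtonPlus_subset {f : Series Γ K} {C : Set (MR M)} (hC : Convex ℝ C)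
    (h : ∀ m ∈ f.supp, ∀ x ∈ dualCone Γ, toMR (m : M) + x ∈ C) : newtonPlus f ⊆ C := by
  refine convexHull_min ?_ hC
  rintro _ hx
  obtain ⟨⟨m, hm⟩, y, hy, rfl⟩ := Set.mem_iUnion.1 hx
  exact h m hm y hy

theorem add_toMR_mem_newtonPlus {f : Series Γ K} {x : MR M} (hx : x ∈ newtonPlus f) {γ : M}
    (hγ : γ ∈ Γ) : x + toMR γ ∈ newtonPlus f := by
  have : newtonPlus f ⊆ (fun x => x + toMR γ) ⁻¹' newtonPlus f := by
    refine newtonPlus_subset ((convex_newtonPlus f).translate_preimage_left _) ?_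
    intro m hm y hy
    refine subset_convexHull _ _ (Set.mem_iUnion.2 ⟨⟨m, hm⟩, y + toMR γ, ?_, ?_⟩)
    · exact Submodule.add_mem _ hy (Submodule.subset_span ⟨γ, hγ, rfl⟩)
    · show toMR (m : M) + (y + toMR γ) = toMR (m : M) + y + toMR γ
      rw [add_assoc]
  exact this hx

theorem weight_le_of_mem_newtonPlus {f : Series Γ K} {w : NR M} (hw : w ∈ cone Γ) {m : Γ}
    (hm : m ∈ minimizers w f.supp) {x : MR M} (hx : x ∈ newtonPlus f) : weight w m ≤ w x := by
  refine newtonPlus_subset (C := {x | weight w m ≤ w x}) ?_ ?_ hx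
  · exact convex_halfSpace_ge w.isLinear _
  · intro m' hm' y hy
    show _ ≤ w (toMR (m' : M) + y)
    rw [map_add]
    exact (hm.2 m' hm').trans (le_add_of_nonneg_right (hw y hy))

/-- A convex combination giving positive weight to a point above the hyperplane lies above it. The
set serves as a convex container of the extended Newton diagram that meets the supporting hyperplane
only in `Q`. -/
theorem convex_union_lt {l : NR M} {c : ℝ} {Q : Set (MR M)} (hQ : Convex ℝ Q)
    (hQc : ∀ x ∈ Q, l x = c) : Convex ℝ {x | x ∈ Q ∨ c < l x} := by
  have hge : ∀ x ∈ {x | x ∈ Q ∨ c < l x}, c ≤ l x := by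
    rintro x (hx | hx)
    · exact (hQc x hx).ge
    · exact hx.le
  intro x hx y hy a b ha hb hab
  by_cases hxQ : x ∈ Q
  · by_cases hyQ : y ∈ Q
    · exact Or.inl (hQ hxQ hyQ ha hb hab)
    · have hy' : c < l y := hy.resolve_left hyQ
      rcases hb.eq_or_lt with rfl | hb
      · rw [add_zero] at hab
        simpa [hab] using hx
      · refine Or.inr ?_
        rw [map_add, map_smul, map_smul, smul_eq_mul, smul_eq_mul, hQc x hxQ]
        have := mul_lt_mul_of_pos_left hy' hb
        have h2 : a * c + b * c = c := by rw [← add_mul, hab, one_mul]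
        linarith
  · have hx' : c < l x := hx.resolve_left hxQ
    rcases ha.eq_or_lt with rfl | ha
    · rw [zero_add] at hab
      simpa [hab] using hy
    · refine Or.inr ?_
      rw [map_add, map_smul, map_smul, smul_eq_mul, smul_eq_mul]
      have := mul_lt_mul_of_pos_left hx' ha
      have h1 := mul_le_mul_of_nonneg_left (hge y hy) hb
      have h2 : a * c + b * c = c := by rw [← add_mul, hab, one_mul]
      linarith

/-- The face of the extended Newton diagram cut by a positive functional is spanned by the
exponents of minimal weight. -/
theorem newtonPlus_face_eq {f : Series Γ K} {l : NR M} (hl : IsPositive Γ l) {m₀ : Γ}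
    (hm₀ : m₀ ∈ minimizers l f.supp) :
    {x ∈ newtonPlus f | ∀ y ∈ newtonPlus f, l x ≤ l y} =
      convexHull ℝ ((fun m : Γ => toMR (m : M)) '' minimizers l f.supp) := by
  have hle : ∀ y ∈ newtonPlus f, weight l m₀ ≤ l y := fun y hy =>
    weight_le_of_mem_newtonPlus hl.mem_cone hm₀ hy
  have hQc : ∀ x ∈ convexHull ℝ ((fun m : Γ => toMR (m : M)) '' minimizers l f.supp),
      l x = weight l m₀ := by
    intro x hx
    refine convexHull_min (t := {x | l x = weight l m₀}) ?_ (convex_hyperplane l.isLinear _) hx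
    rintro _ ⟨m, hm, rfl⟩
    exact weight_eq_of_mem_minimizers hm hm₀
  refine Set.Subset.antisymm ?_ ?_
  · rintro x ⟨hx, hmin⟩
    have hsub := newtonPlus_subset (f := f) (convex_union_lt (convex_convexHull ℝ _) hQc) (by
      intro m hm y hy
      by_cases hm' : m ∈ minimizers l f.supp
      · rcases hl.eq_zero_or_pos hy with rfl | hy
        · rw [add_zero]
          exact Or.inl (subset_convexHull _ _ ⟨m, hm', rfl⟩)
        · refine Or.inr ?_
          rw [map_add, ← weight_apply, weight_eq_of_mem_minimizers hm₀ hm']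
          exact lt_add_of_pos_right _ hy
      · refine Or.inr ?_
        rw [map_add, ← weight_apply]
        have h1 : weight l m₀ < weight l m := by
          by_contra! h
          exact hm' (mem_minimizers_of_weight_le hm₀ hm h)
        exact h1.trans_le (le_add_of_nonneg_right (hl.mem_cone y hy)))
    exact (hsub hx).resolve_right (hmin _ (toMR_mem_newtonPlus hm₀.1)).not_gt
  · intro x hx
    refine ⟨convexHull_min ?_ (convex_newtonPlus f) hx, fun y hy => (hQc x hx).trans_le (hle y hy)⟩
    rintro _ ⟨m, hm, rfl⟩
    exact toMR_mem_newtonPlus hm.1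

theorem isCompactFace_of_isPositive (hΓ : Γ.FG) {f : Series Γ K} (hf : f ≠ 0) {l : NR M}
    (hl : IsPositive Γ l) :
    IsCompactFace f (convexHull ℝ ((fun m : Γ => toMR (m : M)) '' minimizers l f.supp)) := by
  obtain ⟨m₀, hm₀⟩ := minimizers_nonempty hΓ hl.mem_cone (Series.supp_nonempty hf)
  refine ⟨⟨⟨_, subset_convexHull _ _ ⟨m₀, hm₀, rfl⟩⟩, l, (newtonPlus_face_eq hl hm₀).symm⟩, ?_⟩
  let : TopologicalSpace (MR M) := moduleTopology ℝ (MR M)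
  have : IsModuleTopology ℝ (MR M) := ⟨rfl⟩
  have : ContinuousAdd (MR M) := IsModuleTopology.toContinuousAdd ℝ (MR M)
  have : ContinuousSMul ℝ (MR M) := IsModuleTopology.toContinuousSMul ℝ (MR M)
  have : IsTopologicalAddGroup (MR M) := IsModuleTopology.topologicalAddGroup ℝ (MR M)
  exact ((finite_minimizers hΓ hl _).image _).isCompact_convexHull ℝ

/-- Two exponents of `f` are minimal both for the weight `w` and for some positive functional. -/
def IsTie (w : NR M) (f : Series Γ K) : Prop :=
  ∃ l, IsPositive Γ l ∧ ∃ a b, a ≠ b ∧ a ∈ minimizers w f.supp ∧ b ∈ minimizers w f.supp ∧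
    a ∈ minimizers l f.supp ∧ b ∈ minimizers l f.supp

theorem minimizers_add_subset {w l : NR M} {S : Set Γ} {a : Γ} (haw : a ∈ minimizers w S)
    (hal : a ∈ minimizers l S) : minimizers (w + l) S ⊆ minimizers w S := by
  intro m hm
  refine mem_minimizers_of_weight_le haw hm.1 ?_
  have h1 := hm.2 a haw.1
  have h2 := hal.2 m hm.1
  simp only [weight_add] at h1
  linarith

theorem mem_minimizers_add {w l : NR M} {S : Set Γ} {a : Γ} (haw : a ∈ minimizers w S)
    (hal : a ∈ minimizers l S) : a ∈ minimizers (w + l) S := by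
  refine ⟨haw.1, fun m hm => ?_⟩
  simp only [weight_add]
  exact add_le_add (haw.2 m hm) (hal.2 m hm)

theorem mem_minimizers_smul {l : NR M} {S : Set Γ} {a : Γ} {ε : ℝ} (hε : 0 ≤ ε)
    (hal : a ∈ minimizers l S) : a ∈ minimizers (ε • l) S := by
  refine ⟨hal.1, fun m hm => ?_⟩
  simp only [weight_smul]
  exact mul_le_mul_of_nonneg_left (hal.2 m hm) hε

/-- A functional defining a compact face of the extended Newton diagram is positive. -/
theorem isPositive_of_isCompact [Module.Free ℤ M] [Module.Finite ℤ M] {f : Series Γ K}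
    {l : NR M} {x₀ : MR M} (hx₀ : x₀ ∈ {x ∈ newtonPlus f | ∀ y ∈ newtonPlus f, l x ≤ l y})
    (hc : @IsCompact (MR M) (moduleTopology ℝ (MR M))
      {x ∈ newtonPlus f | ∀ y ∈ newtonPlus f, l x ≤ l y}) : IsPositive Γ l := by
  intro γ hγ hne
  have hge : ∀ x ∈ newtonPlus f, l x₀ ≤ l x := hx₀.2
  have h0 : 0 ≤ weight l γ := by
    have := hge _ (add_toMR_mem_newtonPlus hx₀.1 hγ)
    rw [map_add] at this
    exact nonneg_of_le_add_right this
  refine lt_of_le_of_ne h0 fun hzero => ?_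
  obtain ⟨u, hu⟩ := functional_separates hne
  let : TopologicalSpace (MR M) := moduleTopology ℝ (MR M)
  have : IsModuleTopology ℝ (MR M) := ⟨rfl⟩
  -- If `l` vanished at `γ`, the face would contain all the points `x₀ + n γ`, on which `u` is
  -- unbounded.
  have hb := (hc.image (IsModuleTopology.continuous_of_linearMap u)).isBounded
  obtain ⟨C, hC⟩ := hb.exists_norm_le
  have hn : ∀ n : ℕ, |u x₀ + n * u (toMR γ)| ≤ C := by
    intro n
    refine hC _ ⟨x₀ + toMR (n • γ), ⟨add_toMR_mem_newtonPlus hx₀.1 (nsmul_mem hγ n),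
      fun y hy => ?_⟩, ?_⟩
    · rw [map_add, ← weight_apply, map_nsmul, ← hzero, smul_zero, add_zero]
      exact hge y hy
    · rw [map_add, toMR_nsmul, map_smul, smul_eq_mul]
  obtain ⟨n, hn'⟩ := exists_nat_gt ((C + |u x₀|) / |u (toMR γ)|)
  rw [div_lt_iff₀ (abs_pos.2 hu)] at hn'
  have h1 := hn n
  have h2 : |(n : ℝ) * u (toMR γ)| ≤ |u x₀ + n * u (toMR γ)| + |u x₀| := by
    have := abs_sub (u x₀ + n * u (toMR γ)) (u x₀)
    simpa using this
  rw [abs_mul, Nat.abs_cast] at h2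
  linarith

/-- Compact faces are exactly those cut by positive functionals, and each is the convex hull of its
minimal exponents; so it has positive dimension exactly when two exponents of `f` are minimal for
the functional. -/
theorem mem_newtonCone_iff [Module.Free ℤ M] [Module.Finite ℤ M] (hΓ : Γ.FG) {f : Series Γ K}
    {w : NR M} : w ∈ newtonCone f ↔ w ∈ cone Γ ∧ (f = 0 ∨ IsTie w f) := by
  refine and_congr_right fun hw => ?_
  by_cases hf : f = 0
  · simp [hf]
  simp only [hf, false_or]
  constructor
  · rintro ⟨F, hF, ⟨x, hx, y, hy, hxy⟩, hmin⟩
    obtain ⟨⟨-, l, rfl⟩, hc⟩ := id hF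
    have hl : IsPositive Γ l := isPositive_of_isCompact hx hc
    obtain ⟨m₀, hm₀⟩ := minimizers_nonempty hΓ hl.mem_cone (Series.supp_nonempty hf)
    have hnt : (minimizers l f.supp).Nontrivial := by
      by_contra h
      rw [Set.not_nontrivial_iff] at h
      rw [newtonPlus_face_eq hl hm₀, h.eq_singleton_of_mem hm₀, Set.image_singleton,
        convexHull_singleton] at hx hy
      exact hxy (hx.trans hy.symm)
    obtain ⟨m₁, hm₁⟩ := minimizers_nonempty hΓ hw (Series.supp_nonempty hf)
    -- The hypothesis compares `w` only with points of the Newton diagram. The positive functional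
    -- `w + ε • l` cuts a compact face containing a `w`-minimal exponent, so the minimum of `w` on
    -- the diagram is its minimum on all exponents.
    obtain ⟨ε, hε, hpert⟩ := exists_perturbation hΓ hw hl.mem_cone hm₁
    have hl' := hl.add_smul hw hε
    obtain ⟨m₂, hm₂⟩ := minimizers_nonempty hΓ hl'.mem_cone (Series.supp_nonempty hf)
    have hm₂w : m₂ ∈ minimizers w f.supp := by
      by_contra h
      exact (hpert m₂ hm₂.1 h).not_ge (hm₂.2 m₁ hm₁.1)
    have hdiag : toMR (m₂ : M) ∈ newtonDiagram f :=
      ⟨_, isCompactFace_of_isPositive hΓ hf hl', subset_convexHull _ _ ⟨m₂, hm₂, rfl⟩⟩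
    have hall : ∀ a ∈ minimizers l f.supp, a ∈ minimizers w f.supp := by
      intro a ha
      refine mem_minimizers_of_weight_le hm₂w ha.1 (hmin _ ?_ _ hdiag)
      rw [newtonPlus_face_eq hl hm₀]
      exact subset_convexHull _ _ ⟨a, ha, rfl⟩
    obtain ⟨a, ha, b, hb, hab⟩ := hnt
    exact ⟨l, hl, a, b, hab, hall a ha, hall b hb, ha, hb⟩
  · rintro ⟨l, hl, a, b, hab, haw, hbw, hal, hbl⟩
    -- The required face is the one cut by `w + l`: as `w` and `l` share minimizers, those of `w +
    -- l` are minimal for `w`.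
    have hl' : IsPositive Γ (w + l) := by simpa using hl.add_smul hw one_pos
    refine ⟨_, isCompactFace_of_isPositive hΓ hf hl', ?_, ?_⟩
    · exact ⟨_, subset_convexHull _ _ ⟨a, mem_minimizers_add haw hal, rfl⟩,
        _, subset_convexHull _ _ ⟨b, mem_minimizers_add hbw hbl, rfl⟩,
        fun h => hab (Subtype.ext (toMR_injective h))⟩
    · rintro x hx y ⟨F, ⟨⟨-, u, rfl⟩, -⟩, hy⟩
      have hxw : w x = weight w a := by
        refine convexHull_min (t := {x | w x = weight w a}) ?_ (convex_hyperplane w.isLinear _) hx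
        rintro _ ⟨m, hm, rfl⟩
        exact weight_eq_of_mem_minimizers (minimizers_add_subset haw hal hm) haw
      rw [hxw]
      exact weight_le_of_mem_newtonPlus hw haw hy.1

end NewtonCones

/-! ### Construction of valuations with prescribed values on monomials -/

section QuotientSeminorm

open Series

variable {M : Type*} [AddCommGroup M] {Γ : AddSubmonoid M} [PointedAffine Γ] {K : Type*} [Field K]

/-- The norm of `χ^c g - f h` for the monomial norm of weight `w` is at most `r` times the norm of
`χ^c`, for some `c` and `h`. -/
def IsNormBound (w : NR M) (f g : Series Γ K) (r : ℝ) : Prop :=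
  0 ≤ r ∧ ∃ (c : Γ) (h : Series Γ K), ∀ m ∈ (monomial K c * g - f * h).supp,
    Real.exp (weight w c - weight w m) ≤ r

/-- The seminorm on `K[[Γ]]` induced by the residue seminorm of the monomial norm of weight `w` on
the quotient by `f` of the localization of `K[[Γ]]` at the monomials. -/
def quotSeminorm (w : NR M) (f g : Series Γ K) : ℝ := sInf {r | IsNormBound w f g r}

variable {w : NR M} {f g g' : Series Γ K} {r r' : ℝ}

theorem isNormBound_one (hw : w ∈ cone Γ) (f g : Series Γ K) : IsNormBound w f g 1 := by
  refine ⟨zero_le_one, 0, 0, fun m _ => ?_⟩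
  rw [AddSubmonoid.coe_zero, map_zero, zero_sub, Real.exp_le_one_iff, neg_nonpos]
  exact weight_nonneg hw m.2

theorem quotSeminorm_le (h : IsNormBound w f g r) : quotSeminorm w f g ≤ r :=
  csInf_le ⟨0, fun _ h => h.1⟩ h

theorem exists_isNormBound (hw : w ∈ cone Γ) (h : quotSeminorm w f g < r) :
    ∃ r' < r, IsNormBound w f g r' := by
  obtain ⟨r', hr', hlt⟩ := exists_lt_of_csInf_lt ⟨1, isNormBound_one hw f g⟩ h
  exact ⟨r', hlt, hr'⟩

theorem quotSeminorm_nonneg (w : NR M) (f g : Series Γ K) : 0 ≤ quotSeminorm w f g :=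
  Real.sInf_nonneg fun _ h => h.1

theorem quotSeminorm_eq_zero (h : f ∣ g) : quotSeminorm w f g = 0 := by
  obtain ⟨k, rfl⟩ := h
  refine le_antisymm (quotSeminorm_le ⟨le_rfl, 0, k, fun m hm => absurd ?_ hm⟩)
    (quotSeminorm_nonneg _ _ _)
  rw [monomial_zero, one_mul, sub_self, coeff_zero]

theorem IsNormBound.neg (h : IsNormBound w f g r) : IsNormBound w f (-g) r := by
  obtain ⟨hr, c, k, h⟩ := h
  refine ⟨hr, c, -k, fun m hm => h m fun h0 => hm ?_⟩
  rw [show monomial K c * -g - f * -k = -(monomial K c * g - f * k) by ring, coeff_neg, h0,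
    neg_zero]

theorem IsNormBound.mul (h : IsNormBound w f g r) (h' : IsNormBound w f g' r') :
    IsNormBound w f (g * g') (r * r') := by
  obtain ⟨hr, c, k, h⟩ := h
  obtain ⟨hr', c', k', h'⟩ := h'
  -- The witness collects the multiples of `f` in the product `(χ^c g - f k)(χ^{c'} g' - f k')`.
  refine ⟨mul_nonneg hr hr', c + c',
    monomial K c * g * k' + k * (monomial K c' * g') - f * k * k', fun m hm => ?_⟩
  rw [show monomial K (c + c') * (g * g') -
      f * (monomial K c * g * k' + k * (monomial K c' * g') - f * k * k') =
      (monomial K c * g - f * k) * (monomial K c' * g' - f * k') by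
    rw [monomial_add]; ring] at hm
  obtain ⟨a, ha, b, hb, rfl⟩ := supp_mul hm
  have := mul_le_mul (h a ha) (h' b hb) (Real.exp_pos _).le hr
  rw [← Real.exp_add] at this
  refine le_trans (le_of_eq ?_) this
  simp only [AddSubmonoid.coe_add, map_add]
  congr 1
  ring

theorem IsNormBound.monomial_mul (a : Γ) (h : IsNormBound w f g r) :
    IsNormBound w f (monomial K a * g) (Real.exp (-weight w a) * r) := by
  obtain ⟨hr, c, k, h⟩ := h
  refine ⟨mul_nonneg (Real.exp_pos _).le hr, c, monomial K a * k, fun m hm => ?_⟩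
  rw [show monomial K c * (monomial K a * g) - f * (monomial K a * k) =
    monomial K a * (monomial K c * g - f * k) by ring] at hm
  obtain ⟨b, hb, rfl⟩ := supp_monomial_mul hm
  have := mul_le_mul_of_nonneg_left (h b hb) (Real.exp_pos (-weight w a)).le
  rw [← Real.exp_add] at this
  refine le_trans (le_of_eq ?_) this
  simp only [AddSubmonoid.coe_add, map_add]
  congr 1
  ring

/-- The factor `χ^c` allowed in the definition absorbs `χ^a`. This gives the reverse inequality that
makes monomials multiplicative for `quotSeminorm`. -/
theorem IsNormBound.of_monomial_mul {a : Γ} (h : IsNormBound w f (monomial K a * g) r) :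
    IsNormBound w f g (Real.exp (weight w a) * r) := by
  obtain ⟨hr, c, k, h⟩ := h
  refine ⟨mul_nonneg (Real.exp_pos _).le hr, c + a, k, fun m hm => ?_⟩
  rw [monomial_add, mul_assoc] at hm
  have := mul_le_mul_of_nonneg_left (h m hm) (Real.exp_pos (weight w a)).le
  rw [← Real.exp_add] at this
  refine le_trans (le_of_eq ?_) this
  simp only [AddSubmonoid.coe_add, map_add]
  congr 1
  ring

theorem IsNormBound.add (h : IsNormBound w f g r) (h' : IsNormBound w f g' r') :
    IsNormBound w f (g + g') (max r r') := by
  obtain ⟨hr, c, k, h⟩ := h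
  obtain ⟨hr', c', k', h'⟩ := h'
  refine ⟨hr.trans (le_max_left _ _), c + c', monomial K c' * k + monomial K c * k',
    fun m hm => ?_⟩
  rw [show monomial K (c + c') * (g + g') - f * (monomial K c' * k + monomial K c * k') =
      monomial K c' * (monomial K c * g - f * k) + monomial K c * (monomial K c' * g' - f * k') by
    rw [monomial_add]; ring] at hm
  rcases supp_add hm with hm | hm
  · obtain ⟨b, hb, rfl⟩ := supp_monomial_mul hm
    refine le_trans (le_of_eq ?_) ((h b hb).trans (le_max_left _ _))
    simp only [AddSubmonoid.coe_add, map_add]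
    congr 1
    ring
  · obtain ⟨b, hb, rfl⟩ := supp_monomial_mul hm
    refine le_trans (le_of_eq ?_) ((h' b hb).trans (le_max_right _ _))
    simp only [AddSubmonoid.coe_add, map_add]
    congr 1
    ring

theorem quotSeminorm_monomial_mul (hw : w ∈ cone Γ) (f : Series Γ K) (a : Γ) (g : Series Γ K) :
    quotSeminorm w f (monomial K a * g) = Real.exp (-weight w a) * quotSeminorm w f g := by
  have hle : ∀ g, quotSeminorm w f (monomial K a * g) ≤
      Real.exp (-weight w a) * quotSeminorm w f g := by
    intro g
    rw [← div_le_iff₀' (Real.exp_pos _)]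
    refine le_of_forall_gt_imp_ge_of_dense fun r hr => ?_
    obtain ⟨r', hr', h⟩ := exists_isNormBound hw hr
    rw [div_le_iff₀' (Real.exp_pos _)]
    exact (quotSeminorm_le (h.monomial_mul a)).trans
      (mul_le_mul_of_nonneg_left hr'.le (Real.exp_pos _).le)
  refine le_antisymm (hle g) (le_of_forall_gt_imp_ge_of_dense fun r hr => ?_)
  obtain ⟨r', hr', h⟩ := exists_isNormBound hw hr
  rw [Real.exp_neg, inv_mul_le_iff₀ (Real.exp_pos _)]
  exact (quotSeminorm_le h.of_monomial_mul).trans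
    (mul_le_mul_of_nonneg_left hr'.le (Real.exp_pos _).le)

/-- If two exponents of `f` are minimal for `w`, no multiple of `f` is the sum of a monomial and
of terms of larger weights. -/
theorem IsTie.exists_weight_le [Module.Free ℤ M] (htie : IsTie w f) (hw : w ∈ cone Γ) (c : Γ)
    (h : Series Γ K) : ∃ m ∈ (monomial K c - f * h).supp, weight w m ≤ weight w c := by
  classical
  by_contra! hlt
  obtain ⟨l, hl, a, b, hab, haw, hbw, hal, hbl⟩ := htie
  have hΓ : Γ.FG := PointedAffine.fg
  have hzero : ∀ m : Γ, weight w m ≤ weight w c → (f * h).coeff m = (monomial K c).coeff m := by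
    intro m hm
    by_contra hne
    refine (hlt m ?_).not_ge hm
    rw [mem_supp, coeff_sub, sub_ne_zero]
    exact fun h => hne h.symm
  have hc : (f * h).coeff c ≠ 0 := by
    rw [hzero c le_rfl, coeff_monomial, if_pos rfl]
    exact one_ne_zero
  -- The decomposition of `c` shows that `h` is nonzero and that the least weights in `f` and in `h`
  -- add up to at most that of `c`.
  obtain ⟨xc, hxc, yc, hyc, hsum⟩ := supp_mul hc
  have hH₁ : (minimizers w h.supp).Nonempty := minimizers_nonempty hΓ hw ⟨yc, hyc⟩
  obtain ⟨y₀, hy₀⟩ := minimizers_nonempty hΓ hl.mem_cone hH₁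
  -- For `f` the tie provides exponents minimal for `w` and `l` simultaneously; for `h` such
  -- exponents may not exist, so minimality is taken lexicographically, first for `w` and then for
  -- `l`. Positivity of `l` makes both sets finite.
  have hFfin : (minimizers w f.supp ∩ minimizers l f.supp).Finite :=
    (finite_minimizers hΓ hl _).subset Set.inter_subset_right
  have hHfin := finite_minimizers hΓ hl (minimizers w h.supp)
  let F := hFfin.toFinset
  let H := hHfin.toFinset
  have hF : ∀ x, x ∈ F ↔ x ∈ minimizers w f.supp ∧ x ∈ minimizers l f.supp := fun x =>
    hFfin.mem_toFinset
  have hH : ∀ y, y ∈ H ↔ y ∈ minimizers l (minimizers w h.supp) := fun y => hHfin.mem_toFinset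
  have hcard : 1 < F.card * H.card := by
    have h1 : 1 < F.card :=
      Finset.one_lt_card.2 ⟨a, (hF a).2 ⟨haw, hal⟩, b, (hF b).2 ⟨hbw, hbl⟩, hab⟩
    have h2 : 0 < H.card := Finset.card_pos.2 ⟨y₀, (hH y₀).2 hy₀⟩
    exact one_lt_mul_of_lt_of_le h1 h2
  have htwo : TwoUniqueSums Γ := by
    have := twoUniqueSums_of_lattice (M := M)
    exact TwoUniqueSums.of_injective_addHom Γ.subtype.toAddHom Subtype.val_injective this
  -- A sum attained once in `F + H` is attained once in the whole product, so its coefficient is a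
  -- product of two nonzero ones and does not cancel. Its weight is at most that of `c`, where `f *
  -- h` agrees with `χ^c`.
  have key : ∀ p ∈ F ×ˢ H, UniqueAdd F H p.1 p.2 → p.1 + p.2 = c := by
    rintro ⟨x, y⟩ hp huniq
    obtain ⟨hx, hy⟩ := Finset.mem_product.1 hp
    have hx' := (hF x).1 hx
    have hy' := (hH y).1 hy
    have hwle : ∀ x' ∈ f.supp, ∀ y' ∈ h.supp,
        weight w x ≤ weight w x' ∧ weight w y ≤ weight w y' := fun x' hx'' y' hy'' =>
      ⟨hx'.1.2 x' hx'', hy'.1.2 y' hy''⟩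
    have hcoeff : (f * h).coeff (x + y) = f.coeff x * h.coeff y := by
      rw [coeff_mul, Finset.sum_eq_single (x, y)]
      · rintro ⟨x', y'⟩ hp' hne
        rw [Finset.HasAntidiagonal.mem_antidiagonal] at hp'
        by_contra hne0
        have hxs : x' ∈ f.supp := left_ne_zero_of_mul hne0
        have hys : y' ∈ h.supp := right_ne_zero_of_mul hne0
        have hval : ((x' : M) + y') = x + y := congrArg (Subtype.val : Γ → M) hp'
        have hws : weight w x' + weight w y' = weight w x + weight w y := by
          rw [← map_add, ← map_add, hval]
        have hls : weight l x' + weight l y' = weight l x + weight l y := by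
          rw [← map_add, ← map_add, hval]
        obtain ⟨h1, h2⟩ := hwle x' hxs y' hys
        have hy'w : y' ∈ minimizers w h.supp := mem_minimizers_of_weight_le hy'.1 hys (by linarith)
        have h3 := hx'.2.2 x' hxs
        have h4 := hy'.2 y' hy'w
        have hx'F : x' ∈ F := (hF x').2 ⟨mem_minimizers_of_weight_le hx'.1 hxs (by linarith),
          mem_minimizers_of_weight_le hx'.2 hxs (by linarith)⟩
        have hy'H : y' ∈ H := (hH y').2 (mem_minimizers_of_weight_le hy' hy'w (by linarith))
        obtain ⟨e1, e2⟩ := huniq hx'F hy'H hp'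
        exact hne (Prod.ext e1 e2)
      · intro hnot
        simp at hnot
    have hle : weight w ((x + y : Γ) : M) ≤ weight w c := by
      obtain ⟨h1, h2⟩ := hwle xc hxc yc hyc
      rw [← hsum, AddSubmonoid.coe_add, AddSubmonoid.coe_add, map_add, map_add]
      linarith
    have h5 := hzero _ hle
    rw [hcoeff, coeff_monomial] at h5
    by_contra hne
    rw [if_neg hne] at h5
    exact mul_ne_zero (mem_supp.1 hx'.1.1) (mem_supp.1 hy'.1.1) h5
  -- The tie gives `F` at least two elements, so there are two such sums; both would be equal to
  -- `c`.
  obtain ⟨p, hp, q, hq, hpq, hup, huq⟩ := htwo.uniqueAdd_of_one_lt_card hcard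
  obtain ⟨hp1, hp2⟩ := Finset.mem_product.1 hp
  have hsum' : p.1 + p.2 = q.1 + q.2 := (key p hp hup).trans (key q hq huq).symm
  obtain ⟨e1, e2⟩ := huq hp1 hp2 hsum'
  exact hpq (Prod.ext e1 e2)

/-- The tie enters here: every representative `χ^c - f h` keeps a term of weight at most that of
`c`, so no admissible bound is below `1`. -/
theorem quotSeminorm_one [Module.Free ℤ M] (hw : w ∈ cone Γ) (hf : f = 0 ∨ IsTie w f) :
    quotSeminorm w f 1 = 1 := by
  refine le_antisymm (quotSeminorm_le (isNormBound_one hw f 1))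
    (le_csInf ⟨1, isNormBound_one hw f 1⟩ ?_)
  rintro r ⟨-, c, h, hbound⟩
  rw [mul_one] at hbound
  obtain ⟨m, hm, hle⟩ : ∃ m ∈ (monomial K c - f * h).supp, weight w m ≤ weight w c := by
    rcases hf with rfl | htie
    · refine ⟨c, ?_, le_rfl⟩
      rw [zero_mul, sub_zero, mem_supp_monomial]
    · exact htie.exists_weight_le hw c h
  refine le_trans ?_ (hbound m hm)
  rw [Real.one_le_exp_iff]
  linarith

theorem isBoundedSeminorm_quotSeminorm [Module.Free ℤ M] (hw : w ∈ cone Γ)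
    (hf : f = 0 ∨ IsTie w f) : IsBoundedSeminorm (quotSeminorm w f) (quotSeminorm w f) where
  nonneg := quotSeminorm_nonneg w f
  zero := quotSeminorm_eq_zero (dvd_zero f)
  one := quotSeminorm_one hw hf
  neg g := by
    have hle : ∀ g, quotSeminorm w f (-g) ≤ quotSeminorm w f g := fun g =>
      le_of_forall_gt_imp_ge_of_dense fun r hr => by
        obtain ⟨r', hr', h⟩ := exists_isNormBound hw hr
        exact (quotSeminorm_le h.neg).trans hr'.le
    exact le_antisymm (hle g) (by simpa using hle (-g))
  add g g' := by
    refine le_of_forall_gt_imp_ge_of_dense fun r hr => ?_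
    obtain ⟨a, ha, h⟩ := exists_isNormBound hw ((le_max_left _ _).trans_lt hr)
    obtain ⟨b, hb, h'⟩ := exists_isNormBound hw ((le_max_right _ _).trans_lt hr)
    exact (quotSeminorm_le (h.add h')).trans (max_le ha.le hb.le)
  mul g g' := by
    refine le_mul_of_forall_lt₀ fun a ha b hb => ?_
    obtain ⟨a', ha', h⟩ := exists_isNormBound hw ha
    obtain ⟨b', hb', h'⟩ := exists_isNormBound hw hb
    exact (quotSeminorm_le (h.mul h')).trans
      (mul_le_mul ha'.le hb'.le h'.1 (h.1.trans ha'.le))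
  le _ := le_rfl
  isMul _ h := h

/-- Every element of the Newton cone is induced by a nonnegative valuation. -/
theorem exists_val_of_isTie [Module.Free ℤ M] (hw : w ∈ cone Γ) (hf : f = 0 ∨ IsTie w f) :
    ∃ v : RealVal (Series Γ K), (∀ g, 0 ≤ v g) ∧ v f = ⊤ ∧
      ∀ m : Γ, v (monomial K m) = (weight w m : ℝ) := by
  have hp := isBoundedSeminorm_quotSeminorm hw hf
  -- Being below `quotSeminorm`, the minimal `q` is at most `1` and vanishes at `f`; being in the
  -- class, it has the prescribed values on monomials.
  obtain ⟨q, hq, hmin⟩ := hp.exists_minimal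
  have hmul : IsMulSeminorm q :=
    ⟨hq.nonneg, hq.zero, hq.one, hq.add, hq.map_mul_of_minimal hmin⟩
  obtain ⟨v, hv⟩ := hmul.exists_val
  have hinj := expNeg_strictAnti.injective
  refine ⟨v, fun g => ?_, ?_, fun m => ?_⟩
  · rw [← expNeg_strictAnti.le_iff_ge, hv, expNeg_zero]
    exact (hq.le g).trans (quotSeminorm_le (isNormBound_one hw f g))
  · apply hinj
    rw [hv, expNeg_top]
    exact le_antisymm ((hq.le f).trans (quotSeminorm_eq_zero dvd_rfl).le) (hq.nonneg f)
  · have hpm : quotSeminorm w f (monomial K m) = Real.exp (-weight w m) := by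
      have := quotSeminorm_monomial_mul hw f m 1
      rwa [mul_one, quotSeminorm_one hw hf, mul_one] at this
    have := (hq.isMul_self (x := monomial K m) fun y => by
      rw [quotSeminorm_monomial_mul hw, hpm]).1
    apply hinj
    rw [hv, this, hpm, expNeg_coe]

end QuotientSeminorm

/-! ### Weights induced by nonnegative valuations -/

section Initial

variable {M : Type*} [AddCommGroup M] {Γ : AddSubmonoid M}

/-- An element which is the unique minimizer of a positive functional is minimal for all positive
functionals, if each of them has only one minimizer. -/
theorem mem_minimizers_of_unique (hΓ : Γ.FG) {T : Set Γ}
    (huniq : ∀ l, IsPositive Γ l → (minimizers l T).Subsingleton) {l₀ l : NR M}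
    (hl₀ : IsPositive Γ l₀) (hl : IsPositive Γ l) {m₀ : Γ} (hm₀ : m₀ ∈ minimizers l₀ T) :
    m₀ ∈ minimizers l T := by
  obtain ⟨D, hDT, hD⟩ := exists_finset_subset_add hΓ T
  let φ : ℝ → NR M := fun t => (1 - t) • l₀ + t • l
  have hφ : ∀ t m, weight (φ t) m = (1 - t) * weight l₀ m + t * weight l m := fun t m => rfl
  have hcont : ∀ m, Continuous fun t => weight (φ t) m := fun m => by
    simp only [hφ]; fun_prop
  have hpos : ∀ t ∈ Set.Icc (0 : ℝ) 1, IsPositive Γ (φ t) := by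
    rintro t ⟨h0, h1⟩ m hm hne
    rw [hφ]
    rcases h0.eq_or_lt with rfl | h0
    · simpa using hl₀ m hm hne
    · exact add_pos_of_nonneg_of_pos (mul_nonneg (sub_nonneg.2 h1) (hl₀ m hm hne).le)
        (mul_pos h0 (hl m hm hne))
  have hmin : ∀ t ∈ Set.Icc (0 : ℝ) 1, ∀ m ∈ T, (∀ d ∈ D, weight (φ t) m ≤ weight (φ t) d) →
      m ∈ minimizers (φ t) T := by
    intro t ht m hm h
    refine ⟨hm, fun m' hm' => ?_⟩
    obtain ⟨d, hd, γ, rfl⟩ := hD m' hm'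
    rw [AddSubmonoid.coe_add, map_add]
    exact (h d hd).trans (le_add_of_nonneg_right (weight_nonneg (hpos t ht).mem_cone γ.2))
  -- Along the segment from `l₀` to `l`, `A` describes where `m₀` is minimal and `B` where another
  -- generator is. These closed sets cover `[0, 1]` and are disjoint on it by uniqueness, so
  -- connectedness leaves only `A`.
  let A : Set ℝ := ⋂ d ∈ D, {t | weight (φ t) m₀ ≤ weight (φ t) d}
  let B : Set ℝ := ⋃ d ∈ {d | d ∈ D ∧ d ≠ m₀}, ⋂ d' ∈ D, {t | weight (φ t) d ≤ weight (φ t) d'}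
  have hA : IsClosed A := isClosed_biInter fun d _ => isClosed_le (hcont _) (hcont _)
  have hB : IsClosed B := by
    refine Set.Finite.isClosed_biUnion (D.finite_toSet.subset fun d hd => hd.1) fun d _ => ?_
    exact isClosed_biInter fun d' _ => isClosed_le (hcont _) (hcont _)
  have hcover : Set.Icc (0 : ℝ) 1 ⊆ A ∪ B := by
    intro t ht
    obtain ⟨m, hm⟩ := minimizers_nonempty hΓ (hpos t ht).mem_cone ⟨m₀, hm₀.1⟩
    by_cases h : m = m₀
    · exact Or.inl (Set.mem_iInter₂.2 fun d hd => h ▸ hm.2 d (hDT hd))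
    · exact Or.inr (Set.mem_biUnion ⟨mem_of_mem_minimizers (hpos t ht) hDT hD hm, h⟩
        (Set.mem_iInter₂.2 fun d hd => hm.2 d (hDT hd)))
  have hdisj : ¬ (Set.Icc (0 : ℝ) 1 ∩ (A ∩ B)).Nonempty := by
    rintro ⟨t, ht, htA, htB⟩
    obtain ⟨d, ⟨hd, hne⟩, htd⟩ := Set.mem_iUnion₂.1 htB
    exact hne (huniq _ (hpos t ht)
      (hmin t ht d (hDT hd) fun d' hd' => Set.mem_iInter₂.1 htd d' hd')
      (hmin t ht m₀ hm₀.1 fun d' hd' => Set.mem_iInter₂.1 htA d' hd'))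
  have h0A : (0 : ℝ) ∈ A := Set.mem_iInter₂.2 fun d hd => by
    show weight (φ 0) m₀ ≤ weight (φ 0) d
    simpa [hφ] using hm₀.2 d (hDT hd)
  have hBempty : ¬ (Set.Icc (0 : ℝ) 1 ∩ B).Nonempty := fun hne =>
    hdisj (isPreconnected_closed_iff.1 isPreconnected_Icc A B hA hB hcover
      ⟨0, ⟨le_rfl, zero_le_one⟩, h0A⟩ hne)
  have h1 : (1 : ℝ) ∈ Set.Icc (0 : ℝ) 1 := ⟨zero_le_one, le_rfl⟩
  have h1A : (1 : ℝ) ∈ A := (hcover h1).resolve_right fun h => hBempty ⟨1, h1, h⟩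
  have hfin := hmin 1 h1 m₀ hm₀.1 fun d hd => Set.mem_iInter₂.1 h1A d hd
  have hφ1 : φ 1 = l := by simp [φ]
  rwa [hφ1] at hfin

/-- The common minimizer `m₀` is minimal for `u + ε l₀` for every `u` in the dual cone and every `ε
> 0`. Letting `ε` tend to `0` gives `u(m₀) ≤ u(m)`, and Farkas' lemma concludes. -/
theorem exists_sub_mem_sat [Module.Free ℤ M] [Module.Finite ℤ M] [hΓ : PointedAffine Γ]
    {T : Set Γ} (hT : T.Nonempty)
    (huniq : ∀ l, IsPositive Γ l → (minimizers l T).Subsingleton) :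
    ∃ m₀ ∈ T, ∀ m ∈ T, (m : M) - m₀ ∈ sat Γ := by
  obtain ⟨l₀, hl₀⟩ := exists_isPositive Γ
  obtain ⟨m₀, hm₀⟩ := minimizers_nonempty hΓ.fg hl₀.mem_cone hT
  refine ⟨m₀, hm₀.1, fun m hm => mem_sat_of_forall_cone hΓ.fg fun u hu => ?_⟩
  rw [toMR_sub, map_sub, sub_nonneg]
  refine le_of_forall_pos_le_add fun ε hε => ?_
  have hpos : 0 < weight l₀ m + 1 := add_pos_of_nonneg_of_pos
    (weight_nonneg hl₀.mem_cone m.2) one_pos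
  have h := (mem_minimizers_of_unique hΓ.fg huniq hl₀
    (hl₀.add_smul hu (div_pos hε hpos)) hm₀).2 m hm
  simp only [weight_add, weight_smul] at h
  have h1 : 0 ≤ ε / (weight l₀ m + 1) * weight l₀ m₀ :=
    mul_nonneg (div_pos hε hpos).le (weight_nonneg hl₀.mem_cone m₀.2)
  have h2 : ε / (weight l₀ m + 1) * weight l₀ m ≤ ε := by
    rw [div_mul_eq_mul_div, div_le_iff₀ hpos]
    exact mul_le_mul_of_nonneg_left (by linarith) hε.le
  show weight u m₀ ≤ weight u m + ε
  linarith

/-- A finite extension of a semigroup inside its saturation and its group of differences has a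
nonempty conductor. -/
theorem exists_conductor (Y : Finset M) (hY : ∀ y ∈ Y, y ∈ sat Γ ∧ ∃ b ∈ Γ, y + b ∈ Γ) :
    ∃ c ∈ Γ, ∀ x ∈ Γ ⊔ AddSubmonoid.closure (Y : Set M), c + x ∈ Γ := by
  classical
  induction Y using Finset.induction_on with
  | empty => exact ⟨0, Γ.zero_mem, fun x hx => by simpa using hx⟩
  | insert y Y _ ih =>
    obtain ⟨c, hc, hcx⟩ := ih fun z hz => hY z (Finset.mem_insert_of_mem hz)
    obtain ⟨⟨N, hN, hNy⟩, b, hb, hyb⟩ := hY y (Finset.mem_insert_self _ _)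
    -- In `k • y` the multiples of `N • y` already lie in `Γ`. Fewer than `N` copies of `y` remain,
    -- and each is moved into `Γ` by one of the `N` copies of `b`.
    refine ⟨c + N • b, add_mem hc (nsmul_mem hb N), fun x hx => ?_⟩
    rw [Finset.coe_insert, Set.insert_eq, Set.union_comm, AddSubmonoid.closure_union,
      ← sup_assoc] at hx
    obtain ⟨d, hd, e, he, rfl⟩ := AddSubmonoid.mem_sup.1 hx
    obtain ⟨k, rfl⟩ := AddSubmonoid.mem_closure_singleton.1 he
    have hd' : d + (k / N) • (N • y) ∈ Γ ⊔ AddSubmonoid.closure (Y : Set M) :=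
      add_mem hd ((le_sup_left (α := AddSubmonoid M)) (nsmul_mem hNy _))
    have hr : k % N < N := Nat.mod_lt _ hN
    have hsum : c + N • b + (d + k • y) =
        (c + (d + (k / N) • (N • y))) + ((N - k % N) • b + (k % N) • (y + b)) := by
      have hk : k • y = (k / N) • (N • y) + (k % N) • y := by
        rw [← mul_smul, ← add_smul, mul_comm, Nat.div_add_mod]
      have hb' : N • b = (N - k % N) • b + (k % N) • b := by
        rw [← add_smul, Nat.sub_add_cancel hr.le]
      rw [hk, hb', smul_add]
      abel
    rw [hsum]
    exact add_mem (hcx _ hd') (add_mem (nsmul_mem hb _) (nsmul_mem hyb _))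

theorem pointedAffine_of_le_sat [Module.Free ℤ M] [Module.Finite ℤ M] [hΓ : PointedAffine Γ]
    {Δ : AddSubmonoid M} (hΔ : Δ.FG) (hle : Δ ≤ sat Γ) : PointedAffine Δ where
  fg := hΔ
  pointed x hx hx' := by
    obtain ⟨n, hn, hnx⟩ := hle hx
    obtain ⟨k, hk, hkx⟩ := hle hx'
    have h1 : (k * n) • x ∈ Γ := by rw [mul_smul]; exact nsmul_mem hnx k
    have h2 : -((k * n) • x) ∈ Γ := by
      rw [mul_comm, mul_smul, ← smul_neg, ← smul_neg]; exact nsmul_mem hkx n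
    have h3 := hΓ.pointed _ h1 h2
    have h4 : ((k * n : ℕ) : ℝ) • toMR x = 0 := by rw [← toMR_nsmul, h3, toMR_zero]
    rcases smul_eq_zero.1 h4 with h | h
    · exact absurd h (by exact_mod_cast (Nat.mul_pos hk hn).ne')
    · exact toMR_injective (h.trans toMR_zero.symm)

end Initial

/-! ### Initial parts of series and valuations infinite on `f` -/

section Valuations

open Series

variable {M : Type*} [AddCommGroup M] {Γ Δ : AddSubmonoid M} [PointedAffine Γ] [PointedAffine Δ]
  {K : Type*} [Field K]

theorem Series.inclusion_restrictTo (h : Γ ≤ Δ) {g : Series Δ K}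
    (hg : ∀ m ∈ g.supp, (m : M) ∈ Γ) : inclusion K h (restrictTo h g) = g := by
  ext ⟨m, hm⟩
  by_cases hmΓ : m ∈ Γ
  · rw [coeff_inclusion h _ hmΓ, coeff_restrictTo]
  · rw [coeff_inclusion_of_notMem h _ hmΓ]
    by_contra hne
    exact hmΓ (hg ⟨m, hm⟩ fun h => hne h.symm)

/-- The series `∑ a_(m+k) χ^k`. -/
def Series.shift (m : Γ) (g : Series Γ K) : Series Γ K := fun k => g.coeff (m + k)

theorem Series.coeff_shift (m k : Γ) (g : Series Γ K) :
    (shift m g).coeff k = g.coeff (m + k) := rfl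

theorem Series.monomial_mul_shift {m : Γ} {g : Series Γ K} (hg : ∀ a ∈ g.supp, ∃ k, a = m + k) :
    monomial K m * shift m g = g := by
  ext a
  by_cases ha : ∃ k, a = m + k
  · obtain ⟨k, rfl⟩ := ha
    rw [monomial_mul_coeff_add, coeff_shift]
  · have h1 : g.coeff a = 0 := by_contra fun h => ha (hg a h)
    rw [h1]
    by_contra h
    obtain ⟨b, -, hb⟩ := supp_monomial_mul h
    exact ha ⟨b, hb⟩

open Classical in
/-- The part of a series with exponents in `S`. -/
def Series.part (S : Set Γ) (f : Series Γ K) : Series Γ K := fun m => if m ∈ S then f.coeff m else 0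

theorem Series.coeff_part_of_mem {S : Set Γ} (f : Series Γ K) {m : Γ} (hm : m ∈ S) :
    (part S f).coeff m = f.coeff m := if_pos hm

theorem Series.coeff_part_of_notMem {S : Set Γ} (f : Series Γ K) {m : Γ} (hm : m ∉ S) :
    (part S f).coeff m = 0 := if_neg hm

/-- The weight induced by a nonnegative valuation is infinite on a nonzero series whose part of
minimal weight is, up to saturation, the product of a monomial and of an invertible series. -/
theorem val_ne_top_of_sub_mem_sat [Module.Free ℤ M] [Module.Finite ℤ M] {w : NR M}
    (hw : w ∈ cone Γ) {f : Series Γ K} {m₀ : Γ} (hm₀ : m₀ ∈ minimizers w f.supp)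
    (hsat : ∀ m ∈ minimizers w f.supp, (m : M) - m₀ ∈ sat Γ) {v : RealVal (Series Γ K)}
    (hv : ∀ g, 0 ≤ v g) (hvw : ∀ m : Γ, v (monomial K m) = (weight w m : ℝ)) : v f ≠ ⊤ := by
  classical
  intro hvf
  obtain ⟨D, hDT, hD⟩ := exists_finset_subset_add (PointedAffine.fg (Γ := Γ))
    (minimizers w f.supp)
  let Y : Finset M := D.image fun d : Γ => (d : M) - m₀
  -- `Δ` contains all differences `m - m₀` of minimal exponents, so over `Δ` the minimal part of `f`
  -- is `χ^{m₀}` times a series with nonzero constant term. Finitely many differences generate it,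
  -- by Dickson's lemma.
  let Δ : AddSubmonoid M := Γ ⊔ AddSubmonoid.closure (Y : Set M)
  have hY : ∀ y ∈ Y, y ∈ sat Γ ∧ ∃ b ∈ Γ, y + b ∈ Γ := by
    intro y hy
    obtain ⟨d, hd, rfl⟩ := Finset.mem_image.1 hy
    exact ⟨hsat d (hDT hd), m₀, m₀.2, by rw [sub_add_cancel]; exact d.2⟩
  obtain ⟨c, hc, hcΔ⟩ := exists_conductor Y hY
  have hle : Γ ≤ Δ := le_sup_left
  have hΔsat : Δ ≤ sat Γ := sup_le (le_sat Γ) (AddSubmonoid.closure_le.2 fun y hy => (hY y hy).1)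
  have : PointedAffine Δ := by
    refine pointedAffine_of_le_sat ?_ hΔsat
    exact (PointedAffine.fg (Γ := Γ)).sup ⟨Y, rfl⟩
  have hsub : ∀ m ∈ minimizers w f.supp, (m : M) - m₀ ∈ Δ := by
    intro m hm
    obtain ⟨d, hd, γ, rfl⟩ := hD m hm
    rw [AddSubmonoid.coe_add, add_sub_right_comm]
    exact add_mem (le_sup_right (α := AddSubmonoid M)
      (AddSubmonoid.subset_closure (Finset.mem_image_of_mem _ hd))) (hle γ.2)
  let p : Series Γ K := part (minimizers w f.supp) f
  let m₁ : Δ := ⟨m₀, hle m₀.2⟩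
  let c₁ : Δ := ⟨c, hle hc⟩
  let u : Series Δ K := shift m₁ (inclusion K hle p)
  have hpu : monomial K m₁ * u = inclusion K hle p := by
    refine monomial_mul_shift ?_
    rintro ⟨a, ha⟩ hmem
    have haΓ : a ∈ Γ := by
      by_contra h
      exact hmem (coeff_inclusion_of_notMem hle p h)
    rw [mem_supp, coeff_inclusion hle p haΓ] at hmem
    have hmin : (⟨a, haΓ⟩ : Γ) ∈ minimizers w f.supp := by
      by_contra h
      exact hmem (coeff_part_of_notMem f h)
    exact ⟨⟨a - m₀, hsub _ hmin⟩, Subtype.ext (add_sub_cancel _ _).symm⟩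
  have hu : IsUnit u := by
    refine isUnit_of_coeff_zero_ne_zero ?_
    rw [coeff_shift, add_zero, coeff_inclusion hle p m₀.2]
    show p.coeff m₀ ≠ 0
    rw [coeff_part_of_mem f hm₀]
    exact hm₀.1
  obtain ⟨u', hu'⟩ := hu.exists_left_inv
  have hq : ∀ m ∈ (monomial K c₁ * u').supp, ∃ δ : Δ, (m : M) = c + δ := by
    intro m hm
    obtain ⟨b, -, rfl⟩ := supp_monomial_mul hm
    exact ⟨b, rfl⟩
  -- The valuation is only defined on `K[[Γ]]`; the conductor brings the inverse of `u` back there.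
  let q : Series Γ K := restrictTo hle (monomial K c₁ * u')
  have hqinc : inclusion K hle q = monomial K c₁ * u' := by
    refine inclusion_restrictTo hle fun m hm => ?_
    obtain ⟨δ, hδ⟩ := hq m hm
    rw [hδ]
    exact hcΔ _ δ.2
  have hqp : q * p = monomial K (⟨c, hc⟩ + m₀) := by
    refine inclusion_injective hle ?_
    rw [map_mul, hqinc, ← hpu, inclusion_monomial]
    have h1 : (⟨((⟨c, hc⟩ + m₀ : Γ) : M), hle (⟨c, hc⟩ + m₀ : Γ).2⟩ : Δ) = c₁ + m₁ := rfl
    rw [h1, monomial_add,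
      show monomial K c₁ * u' * (monomial K m₁ * u) =
        monomial K c₁ * monomial K m₁ * (u' * u) by ring, hu', mul_one]
  have hvq : ((weight w c : ℝ) : WithTop ℝ) ≤ v q := by
    refine le_val hv fun m hm => ?_
    obtain ⟨δ, hδ⟩ := hq ⟨m, hle m.2⟩ hm
    rw [hvw, WithTop.coe_le_coe, show (m : M) = c + δ from hδ, map_add]
    exact le_add_of_nonneg_right (cone_nonneg_sat hw (hΔsat δ.2))
  -- Since `v f = ⊤`, the value of `p` is at least that of `f - p`, all of whose exponents have
  -- strictly larger weight.
  have hvp : ((weight w m₀ : ℝ) : WithTop ℝ) < v p := by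
    have h1 : ((weight w m₀ : ℝ) : WithTop ℝ) < v (f - p) := by
      refine lt_val hv WithTop.coe_ne_top fun m hm => ?_
      rw [hvw, WithTop.coe_lt_coe]
      rw [mem_supp, coeff_sub] at hm
      have hnot : m ∉ minimizers w f.supp := fun h => hm (by rw [coeff_part_of_mem f h, sub_self])
      rw [coeff_part_of_notMem f hnot, sub_zero] at hm
      by_contra! h
      exact hnot (mem_minimizers_of_weight_le hm₀ hm h)
    have h2 := v.map_sub f (f - p)
    rw [sub_sub_cancel, hvf, min_eq_right le_top] at h2
    exact h1.trans_le h2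
  have hsum := WithTop.add_lt_add_of_le_of_lt WithTop.coe_ne_top hvq hvp
  rw [← v.map_mul, hqp, hvw, AddSubmonoid.coe_add, map_add, WithTop.coe_add] at hsum
  exact lt_irrefl _ hsum

/-- Two `l`-minimizers among the `w`-minimal exponents are minimal for `w + ε l` when `ε` is small,
hence form a tie. Without ties the minimizers are therefore unique, and the minimal part of `f` is,
up to saturation, a monomial times a unit. -/
theorem isTie_of_val [Module.Free ℤ M] [Module.Finite ℤ M] {w : NR M} (hw : w ∈ cone Γ)
    {f : Series Γ K} (hf : f ≠ 0) {v : RealVal (Series Γ K)} (hv : ∀ g, 0 ≤ v g)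
    (hvf : v f = ⊤) (hvw : ∀ m : Γ, v (monomial K m) = (weight w m : ℝ)) : IsTie w f := by
  by_contra hno
  have hΓ : Γ.FG := PointedAffine.fg
  have huniq : ∀ l, IsPositive Γ l → (minimizers l (minimizers w f.supp)).Subsingleton := by
    intro l hl a ha b hb
    by_contra hne
    obtain ⟨ε, hε, hpert⟩ := exists_perturbation hΓ hw hl.mem_cone ha.1
    have hmin : ∀ x ∈ minimizers l (minimizers w f.supp),
        x ∈ minimizers (w + ε • l) f.supp := by
      intro x hx
      refine ⟨hx.1.1, fun m hm => ?_⟩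
      by_cases hmw : m ∈ minimizers w f.supp
      · simp only [weight_add, weight_smul]
        exact add_le_add (hx.1.2 m hm) (mul_le_mul_of_nonneg_left (hx.2 m hmw) hε.le)
      · have h1 := (hpert m hm hmw).le
        simp only [weight_add, weight_smul] at h1 ⊢
        rwa [weight_eq_of_mem_minimizers hx.1 ha.1, weight_eq_of_mem_minimizers hx ha]
    exact hno ⟨_, hl.add_smul hw hε, a, b, hne, ha.1, hb.1, hmin a ha, hmin b hb⟩
  obtain ⟨m₀, hm₀, hsat⟩ := exists_sub_mem_sat
    (minimizers_nonempty hΓ hw (supp_nonempty hf)) huniq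
  exact val_ne_top_of_sub_mem_sat hw hm₀ hsat hv hvw hvf

end Valuations

/-! ### Tropicalizations in terms of valuations of the ring of series -/

section Points

variable {M : Type*} [AddCommGroup M] {Γ : AddSubmonoid M}

theorem restrict_extend (h : Γ →+ WithTop ℝ) : restrict Γ (extend Γ h) = h :=
  (Equiv.ofBijective (restrict Γ) (restrict_bijective Γ)).apply_symm_apply h

theorem nsmul_apply_eq_restrict (ω : LinVar Γ) {m : sat Γ} {n : ℕ} (hm : n • (m : M) ∈ Γ) :
    n • ω m = restrict Γ ω ⟨n • (m : M), hm⟩ := by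
  rw [← map_nsmul]
  rfl

theorem mem_extCone_of_restrict {ω : LinVar Γ} (h : ∀ m, 0 ≤ restrict Γ ω m) : ω ∈ extCone Γ := by
  rintro ⟨m, n, hn, hm⟩
  by_contra! hlt
  have h1 := h ⟨n • m, hm⟩
  rw [← nsmul_apply_eq_restrict ω (m := ⟨m, n, hn, hm⟩) hm] at h1
  generalize ω ⟨m, n, hn, hm⟩ = t at h1 hlt
  induction t with
  | top => exact not_top_lt hlt
  | coe r =>
    rw [← WithTop.coe_nsmul, ← WithTop.coe_zero, WithTop.coe_le_coe, nsmul_eq_mul] at h1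
    rw [← WithTop.coe_zero, WithTop.coe_lt_coe] at hlt
    have hn' : (0 : ℝ) < n := by exact_mod_cast hn
    exact (mul_neg_of_pos_of_neg hn' hlt).not_ge h1

theorem mem_extConeInterior_of_restrict [Module.Free ℤ M] [Module.Finite ℤ M] {ω : LinVar Γ}
    (h : ∀ m, m ≠ 0 → 0 < restrict Γ ω m) : ω ∈ extConeInterior Γ := by
  have hext : ω ∈ extCone Γ := mem_extCone_of_restrict fun m => by
    by_cases h0 : m = 0
    · rw [h0, map_zero]
    · exact (h m h0).le
  refine ⟨hext, ?_⟩
  rintro ⟨m, n, hn, hm⟩ hunit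
  refine lt_of_le_of_ne (hext _) fun h0 => ?_
  have h1 := nsmul_apply_eq_restrict ω (m := ⟨m, n, hn, hm⟩) hm
  rw [← h0, smul_zero] at h1
  refine (h ⟨n • m, hm⟩ fun hz => hunit ?_).ne h1
  have h2 : n • m = 0 := congrArg Subtype.val hz
  have h3 : (n : ℝ) • toMR m = 0 := by rw [← toMR_nsmul, h2, toMR_zero]
  have h4 : m = 0 := by
    rcases smul_eq_zero.1 h3 with h | h
    · exact absurd h (by exact_mod_cast hn.ne')
    · exact toMR_injective (h.trans toMR_zero.symm)
  have h5 : (⟨m, n, hn, hm⟩ : sat Γ) = 0 := Subtype.ext h4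
  rw [h5]
  exact isAddUnit_zero

theorem closureIn_subset {X : Type*} [TopologicalSpace X] {A S : Set X} :
    closureIn A S ⊆ closure S :=
  (image_closure_subset_closure_image continuous_subtype_val).trans
    (closure_mono (Set.image_preimage_subset _ _))

theorem mem_closureIn {X : Type*} [TopologicalSpace X] {A S : Set X} {x : X} (hx : x ∈ A)
    (h : x ∈ closure (A ∩ S)) : x ∈ closureIn A S := by
  refine ⟨⟨x, hx⟩, ?_, rfl⟩
  rw [closure_subtype, Subtype.image_preimage_coe]
  exact h

/-- Every real valued morphism on a subsemigroup of `M` is the restriction of a functional. -/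
theorem exists_weight_eq (φ : Γ →+ ℝ) : ∃ w : NR M, ∀ m : Γ, weight w m = φ m := by
  let ι : Algebra.GrothendieckAddGroup Γ →+ M := Algebra.GrothendieckAddGroup.lift Γ.subtype
  have hof : ∀ m : Γ, ι (Algebra.GrothendieckAddGroup.of m) = m := fun m =>
    DFunLike.congr_fun (Algebra.GrothendieckAddGroup.lift.symm_apply_apply Γ.subtype) m
  have hι : Function.Injective ι := by
    rw [injective_iff_map_eq_zero]
    intro x hx
    obtain ⟨⟨a, b⟩, hab⟩ := (AddLocalization.addMonoidOf (⊤ : AddSubmonoid Γ)).surj x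
    have hab' : x + Algebra.GrothendieckAddGroup.of b.1 = Algebra.GrothendieckAddGroup.of a := hab
    have h1 := congrArg ι hab'
    rw [map_add, hx, zero_add, hof, hof] at h1
    rw [Subtype.ext h1] at hab'
    exact add_eq_right.1 hab'
  -- The group of differences of `Γ` is a subgroup of `M`, and `ℝ` is divisible, hence an injective
  -- abelian group.
  obtain ⟨h, hh⟩ := (Module.Baer.of_divisible ℝ).extension_property_addMonoidHom ι hι
    (Algebra.GrothendieckAddGroup.lift φ)
  refine ⟨functionalOf h, fun m => ?_⟩
  rw [weight_apply, functionalOf_toMR, ← hof m]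
  have h2 := DFunLike.congr_fun hh (Algebra.GrothendieckAddGroup.of m)
  refine h2.trans ?_
  exact DFunLike.congr_fun (Algebra.GrothendieckAddGroup.lift.symm_apply_apply φ) m

end Points

/-! ### Descent to the quotient by `f` -/

section Tropicalizations

open Series

variable {M : Type*} [AddCommGroup M] {Γ : AddSubmonoid M} [PointedAffine Γ]
  {K : Type*} [Field K] {f : Series Γ K}

theorem tropMap_eq_iff {v : RealVal (Series Γ K ⧸ Ideal.span {f})} {x : LinVar Γ} :
    tropMap (quotHom (Ideal.span {f})) v = x ↔
      ∀ m : Γ, restrict Γ x m = v (Ideal.Quotient.mk _ (monomial K m)) := by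
  constructor
  · rintro rfl m
    rw [tropMap, restrict_extend]
    rfl
  · intro h
    refine (restrict_bijective Γ).1 (DFunLike.ext _ _ fun m => ?_)
    rw [tropMap, restrict_extend, h m]
    rfl

/-- The valuation of the quotient induced by a valuation which is infinite on `f`. -/
theorem exists_quot_val {V : RealVal (Series Γ K)} (hf : V f = ⊤) :
    ∃ v : RealVal (Series Γ K ⧸ Ideal.span {f}), ∀ g, v (Ideal.Quotient.mk _ g) = V g := by
  have hle : Ideal.span {f} ≤ V.supp := by
    rw [Ideal.span_singleton_le_iff_mem]
    exact (V.mem_supp_iff f).2 hf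
  exact ⟨V.onQuot hle, fun g => rfl⟩

theorem mem_nnTropSeries_iff {x : LinVar Γ} : x ∈ nnTropSeries f ↔
    ∃ V : RealVal (Series Γ K), (∀ g, 0 ≤ V g) ∧ V f = ⊤ ∧
      ∀ m : Γ, restrict Γ x m = V (monomial K m) := by
  constructor
  · rintro ⟨v, hv, hx⟩
    refine ⟨v.comap (Ideal.Quotient.mk _), fun g => hv _, ?_, tropMap_eq_iff.1 hx⟩
    show v (Ideal.Quotient.mk _ f) = ⊤
    rw [Ideal.Quotient.eq_zero_iff_mem.2 (Ideal.mem_span_singleton_self f), v.map_zero]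
  · rintro ⟨V, hV, hf, hx⟩
    obtain ⟨v, hv⟩ := exists_quot_val hf
    refine ⟨v, fun g => ?_, tropMap_eq_iff.2 fun m => by rw [hv, hx]⟩
    obtain ⟨g, rfl⟩ := Ideal.Quotient.mk_surjective g
    rw [hv]
    exact hV g

/-- A series whose class is not a unit has no constant term, so `lt_val` with `c = 0` bounds its
value away from zero by those of nontrivial monomials. -/
theorem mem_image_localVals {x : LinVar Γ} {V : RealVal (Series Γ K)} (hV : ∀ g, 0 ≤ V g)
    (hf : V f = ⊤) (hx : ∀ m : Γ, restrict Γ x m = V (monomial K m))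
    (hpos : ∀ m : Γ, m ≠ 0 → 0 < V (monomial K m)) :
    x ∈ tropMap (quotHom (Ideal.span {f})) '' localVals (Series Γ K ⧸ Ideal.span {f}) := by
  obtain ⟨v, hv⟩ := exists_quot_val hf
  have hv0 : ∀ g, 0 ≤ v g := fun g => by
    obtain ⟨g, rfl⟩ := Ideal.Quotient.mk_surjective g
    rw [hv]
    exact hV g
  refine ⟨v, ⟨hv0, ?_⟩, tropMap_eq_iff.2 fun m => by rw [hv, hx]⟩
  ext g
  constructor
  · rintro (hg : 0 < v g) hunit
    obtain ⟨k, hk⟩ := hunit.exists_right_inv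
    have h1 : v g + v k = 0 := by rw [← v.map_mul, hk, v.map_one]
    exact (add_pos_of_pos_of_nonneg hg (hv0 k)).ne' h1
  · intro hg
    obtain ⟨g, rfl⟩ := Ideal.Quotient.mk_surjective g
    show 0 < v _
    rw [hv]
    refine lt_val hV WithTop.zero_ne_top fun m hm => hpos m ?_
    rintro rfl
    exact hg ((isUnit_of_coeff_zero_ne_zero hm).map _)

/-! ### Strata -/

theorem isMonoidFace_perp {τ : Set (NR M)} (hτ : τ ⊆ cone Γ) : IsMonoidFace (perp Γ τ) Γ where
  le _ hm := hm.1
  mem_left a ha b hb hab := by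
    refine ⟨ha, fun u hu => ?_⟩
    have h := hab.2 u hu
    rw [toMR_add, map_add] at h
    exact ((add_eq_zero_iff_of_nonneg (weight_nonneg (hτ hu) ha)
      (weight_nonneg (hτ hu) hb)).1 h).1

theorem IsFace.subset {V : Type*} [AddCommGroup V] [Module ℝ V] {P F : Set V} (h : IsFace P F) :
    F ⊆ P := by
  obtain ⟨-, l, rfl⟩ := h
  exact Set.sep_subset _ _

theorem restrict_stratumPoint_of_mem {τ : Set (NR M)} (hτ : IsFace (cone Γ) τ) (w : NR M) {m : Γ}
    (hm : (m : M) ∈ perp Γ τ) : restrict Γ (stratumPoint hτ w) m = (weight w m : ℝ) :=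
  if_pos hm.2

theorem restrict_stratumPoint_of_notMem {τ : Set (NR M)} (hτ : IsFace (cone Γ) τ) (w : NR M)
    {m : Γ} (hm : (m : M) ∉ perp Γ τ) : restrict Γ (stratumPoint hτ w) m = ⊤ :=
  if_neg fun h => hm ⟨m.2, h⟩

/-- Deleting the monomials outside a face is a ring morphism `K[[Γ]] → K[[Γ_τ]]` that sends `f` to
`f_τ`. A valuation pulled back along it is infinite exactly on the monomials that are deleted. -/
theorem exists_val_stratumPoint [Module.Free ℤ M] {τ : Set (NR M)} (hτ : IsFace (cone Γ) τ)
    {w : NR M} (hw : w ∈ cone (perp Γ τ)) (hf : truncation τ f = 0 ∨ IsTie w (truncation τ f)) :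
    ∃ V : RealVal (Series Γ K), (∀ g, 0 ≤ V g) ∧ V f = ⊤ ∧
      ∀ m : Γ, restrict Γ (stratumPoint hτ w) m = V (monomial K m) := by
  have hface := isMonoidFace_perp hτ.subset
  have := hface.pointedAffine
  obtain ⟨v, hv, hvf, hvw⟩ := exists_val_of_isTie hw hf
  refine ⟨v.comap (restrictFace K hface), fun g => hv _, hvf, fun m => ?_⟩
  show _ = v (restrictFace K hface (monomial K m))
  by_cases hm : (m : M) ∈ perp Γ τ
  · rw [restrict_stratumPoint_of_mem hτ w hm]
    have h1 : restrictFace K hface (monomial K m) = monomial K (⟨m, hm⟩ : perp Γ τ) :=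
      restrictFace_monomial_of_mem hface hm
    rw [h1, hvw]
  · rw [restrict_stratumPoint_of_notMem hτ w hm, restrictFace_monomial_of_notMem hface hm,
      v.map_zero]

/-- The face of `Γ` where a nonnegative morphism is finite corresponds to a face of `σ`. -/
theorem exists_isFace_perp_eq [Module.Free ℤ M] [Module.Finite ℤ M] {Γ' : AddSubmonoid M}
    (hface : IsMonoidFace Γ' Γ) : ∃ τ, IsFace (cone Γ) τ ∧ perp Γ τ = Γ' := by
  obtain ⟨S, hS⟩ := hface.pointedAffine.fg
  have hSΓ' : ∀ s ∈ S, s ∈ Γ' := fun s hs => by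
    rw [← hS]; exact AddSubmonoid.subset_closure hs
  -- The sum of generators lies in the relative interior of the face, so a functional of `σ`
  -- vanishes on all of `Γ'` as soon as it vanishes at `m₀`.
  let m₀ : M := ∑ s ∈ S, s
  have hm₀ : m₀ ∈ Γ' := Γ'.sum_mem hSΓ'
  have hzero : (0 : NR M) ∈ cone Γ := fun x _ => le_rfl
  have hτ : {u ∈ cone Γ | ∀ u' ∈ cone Γ,
      Module.Dual.eval ℝ (MR M) (toMR m₀) u ≤ Module.Dual.eval ℝ (MR M) (toMR m₀) u'} =
      {u ∈ cone Γ | weight u m₀ = 0} := by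
    ext u
    refine and_congr_right fun hu => ⟨fun h => ?_, fun h u' hu' => ?_⟩
    · exact le_antisymm (h 0 hzero) (weight_nonneg hu (hface.le hm₀))
    · exact h.le.trans (weight_nonneg hu' (hface.le hm₀))
  refine ⟨{u ∈ cone Γ | weight u m₀ = 0}, ⟨⟨0, hzero, rfl⟩, _, hτ.symm⟩, ?_⟩
  obtain ⟨u, hu, hu0⟩ := hface.exists_weight_eq_zero_iff PointedAffine.fg
  ext m
  constructor
  · rintro ⟨hm, h⟩
    exact (hu0 m hm).1 (h u ⟨hu, (hu0 m₀ (hface.le hm₀)).2 hm₀⟩)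
  · intro hm
    refine ⟨hface.le hm, ?_⟩
    rintro u' ⟨hu', hu'0⟩
    have hgen : ∀ s ∈ S, weight u' s = 0 := by
      rw [map_sum] at hu'0
      exact (Finset.sum_eq_zero_iff_of_nonneg fun s hs =>
        weight_nonneg hu' (hface.le (hSΓ' s hs))).1 hu'0
    rw [← hS] at hm
    exact AddSubmonoid.closure_le (S := AddMonoidHom.mker (weight u')).2 hgen hm

/-- The elements of `Γ` with finite value form a face, hence `Γ_τ` for some `τ`; there the values
define a weight, and the restriction of `V` to the subring `K[[Γ_τ]]` is infinite on `f_τ`. -/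
theorem exists_stratumPoint_of_val [Module.Free ℤ M] [Module.Finite ℤ M] {x : LinVar Γ}
    {V : RealVal (Series Γ K)} (hV : ∀ g, 0 ≤ V g) (hf : V f = ⊤)
    (hx : ∀ m : Γ, restrict Γ x m = V (monomial K m)) :
    ∃ (τ : Set (NR M)) (hτ : IsFace (cone Γ) τ), ∃ w ∈ newtonCone (truncation τ f),
      stratumPoint hτ w = x := by
  let Γ' : AddSubmonoid M :=
    { carrier := {m | ∃ h : m ∈ Γ, restrict Γ x ⟨m, h⟩ ≠ ⊤}
      zero_mem' := ⟨Γ.zero_mem, by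
        have : restrict Γ x ⟨0, Γ.zero_mem⟩ = 0 := map_zero _
        rw [this]
        exact WithTop.zero_ne_top⟩
      add_mem' := by
        rintro a b ⟨ha, ha'⟩ ⟨hb, hb'⟩
        refine ⟨add_mem ha hb, ?_⟩
        have : restrict Γ x ⟨a + b, add_mem ha hb⟩ = restrict Γ x ⟨a, ha⟩ + restrict Γ x ⟨b, hb⟩ :=
          map_add (restrict Γ x) ⟨a, ha⟩ ⟨b, hb⟩
        rw [this]
        exact WithTop.add_ne_top.2 ⟨ha', hb'⟩ }
  have hface' : IsMonoidFace Γ' Γ := by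
    refine ⟨fun m hm => hm.1, ?_⟩
    rintro a ha b hb ⟨_, hab⟩
    have : restrict Γ x ⟨a + b, add_mem ha hb⟩ = restrict Γ x ⟨a, ha⟩ + restrict Γ x ⟨b, hb⟩ :=
      map_add (restrict Γ x) ⟨a, ha⟩ ⟨b, hb⟩
    rw [this] at hab
    exact ⟨ha, (WithTop.add_ne_top.1 hab).1⟩
  obtain ⟨τ, hτ, hperp⟩ := exists_isFace_perp_eq hface'
  have hmem : ∀ m : Γ, (m : M) ∈ perp Γ τ ↔ restrict Γ x m ≠ ⊤ := by
    intro m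
    rw [hperp]
    exact ⟨fun h => h.2, fun h => ⟨m.2, h⟩⟩
  have hface := isMonoidFace_perp hτ.subset
  have := hface.pointedAffine
  let ρ : perp Γ τ →+ WithTop ℝ := (restrict Γ x).comp (AddSubmonoid.inclusion hface.le)
  have hρ : ∀ m, ρ m ≠ ⊤ := fun m => (hmem ⟨m, hface.le m.2⟩).1 m.2
  let φ : perp Γ τ →+ ℝ :=
    { toFun := fun m => (ρ m).untop (hρ m)
      map_zero' := by simp
      map_add' := fun a b => by
        rw [← WithTop.coe_inj]
        simp }
  obtain ⟨w, hw⟩ := exists_weight_eq φ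
  have hwρ : ∀ m : perp Γ τ, ((weight w m : ℝ) : WithTop ℝ) = ρ m := fun m => by
    rw [hw]
    exact WithTop.coe_untop _ _
  have hVm : ∀ m : perp Γ τ, V (inclusion K hface.le (monomial K m)) = (weight w m : ℝ) := by
    intro m
    rw [inclusion_monomial, ← hx, hwρ]
    rfl
  have hwcone : w ∈ cone (perp Γ τ) := mem_cone_iff.2 fun m hm => by
    have h1 := hV (inclusion K hface.le (monomial K ⟨m, hm⟩))
    rw [hVm, ← WithTop.coe_zero, WithTop.coe_le_coe] at h1
    exact h1
  have hVf : V (inclusion K hface.le (truncation τ f)) = ⊤ := by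
    -- All monomials of `f - f_τ` have infinite value, and `le_val` is valid with `c = ⊤`.
    have h1 : ⊤ ≤ V (f - inclusion K hface.le (truncation τ f)) := by
      refine le_val hV fun m hm => ?_
      rw [← hx, top_le_iff]
      by_contra hne
      have hmp := (hmem m).2 hne
      refine hm ?_
      rw [coeff_sub]
      have h2 : (inclusion K hface.le (truncation τ f)).coeff m = f.coeff m :=
        coeff_inclusion hface.le (truncation τ f) hmp
      rw [h2, sub_self]
    have h2 := V.map_sub f (f - inclusion K hface.le (truncation τ f))
    rw [sub_sub_cancel, hf, top_le_iff.1 h1, min_self] at h2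
    exact top_le_iff.1 h2
  refine ⟨τ, hτ, w, (mem_newtonCone_iff PointedAffine.fg).2 ⟨hwcone, ?_⟩, ?_⟩
  · by_cases h0 : truncation τ f = 0
    · exact Or.inl h0
    · exact Or.inr (isTie_of_val hwcone h0 (v := V.comap (inclusion K hface.le))
        (fun g => hV _) hVf hVm)
  · refine (restrict_bijective Γ).1 (DFunLike.ext _ _ fun m => ?_)
    by_cases hm : (m : M) ∈ perp Γ τ
    · rw [restrict_stratumPoint_of_mem hτ w hm]
      exact hwρ ⟨m, hm⟩
    · rw [restrict_stratumPoint_of_notMem hτ w hm]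
      exact (not_not.1 fun h => hm ((hmem m).2 h)).symm

theorem nnTropSeries_eq [Module.Free ℤ M] [Module.Finite ℤ M] (f : Series Γ K) :
    nnTropSeries f = extendedNewtonCone f := by
  ext x
  rw [mem_nnTropSeries_iff]
  constructor
  · rintro ⟨V, hV, hf, hx⟩
    obtain ⟨τ, hτ, w, hw, hwx⟩ := exists_stratumPoint_of_val hV hf hx
    exact Set.mem_iUnion₂.2 ⟨τ, hτ, w, hw, hwx⟩
  · intro hx
    obtain ⟨τ, hτ, w, hw, rfl⟩ := Set.mem_iUnion₂.1 hx
    have := (isMonoidFace_perp hτ.subset).pointedAffine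
    obtain ⟨hw, hf⟩ := (mem_newtonCone_iff PointedAffine.fg).1 hw
    exact exists_val_stratumPoint hτ hw hf

/-! ### Topology -/

theorem continuous_stratumPoint {τ : Set (NR M)} (hτ : IsFace (cone Γ) τ) (w l : NR M) :
    Continuous fun ε : ℝ => stratumPoint hτ (w + ε • l) := by
  refine continuous_induced_rng.2 (continuous_pi fun m => ?_)
  by_cases hm : ∀ u ∈ τ, u (toMR (m : M)) = 0
  · have h1 : (fun ε : ℝ => (stratumPoint hτ (w + ε • l)) m) =
        fun ε : ℝ => ((weight w m + ε * weight l m : ℝ) : WithTop ℝ) := by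
      funext ε
      exact if_pos hm
    show Continuous fun ε : ℝ => (stratumPoint hτ (w + ε • l)) m
    rw [h1]
    exact WithTop.continuous_coe.comp (by fun_prop)
  · have h1 : (fun ε : ℝ => (stratumPoint hτ (w + ε • l)) m) = fun _ => ⊤ := by
      funext ε
      exact if_neg hm
    show Continuous fun ε : ℝ => (stratumPoint hτ (w + ε • l)) m
    rw [h1]
    exact continuous_const

/-- The approximation stays in the stratum of `τ`. The tie persists along `w + ε l` because `l` is
its own positive functional, and the resulting morphism is positive on nonzero elements: through `l`
on `Γ_τ`, and by being `+∞` elsewhere. -/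
theorem stratumPoint_mem_closure [Module.Free ℤ M] [Module.Finite ℤ M] {τ : Set (NR M)}
    (hτ : IsFace (cone Γ) τ) {w : NR M} (hw : w ∈ newtonCone (truncation τ f)) :
    stratumPoint hτ w ∈ closure (extConeInterior Γ ∩
      tropMap (quotHom (Ideal.span {f})) '' localVals (Series Γ K ⧸ Ideal.span {f})) := by
  have := (isMonoidFace_perp hτ.subset).pointedAffine
  obtain ⟨hw, hf⟩ := (mem_newtonCone_iff PointedAffine.fg).1 hw
  obtain ⟨l, hl, hwl⟩ : ∃ l, IsPositive (perp Γ τ) l ∧ ∀ ε : ℝ, 0 < ε →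
      (truncation τ f = 0 ∨ IsTie (w + ε • l) (truncation τ f)) := by
    rcases hf with h0 | ⟨l, hl, a, b, hab, haw, hbw, hal, hbl⟩
    · obtain ⟨l, hl⟩ := exists_isPositive (perp Γ τ)
      exact ⟨l, hl, fun _ _ => Or.inl h0⟩
    · exact ⟨l, hl, fun ε hε => Or.inr ⟨l, hl, a, b, hab,
        mem_minimizers_add haw (mem_minimizers_smul hε.le hal),
        mem_minimizers_add hbw (mem_minimizers_smul hε.le hbl), hal, hbl⟩⟩
  have hlim : Filter.Tendsto (fun ε : ℝ => stratumPoint hτ (w + ε • l)) (nhdsWithin 0 (Set.Ioi 0))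
      (nhds (stratumPoint hτ w)) := by
    have h := ((continuous_stratumPoint hτ w l).tendsto 0).mono_left
      (nhdsWithin_le_nhds (s := Set.Ioi 0))
    rwa [zero_smul, add_zero] at h
  refine mem_closure_of_tendsto hlim (Filter.eventually_of_mem self_mem_nhdsWithin ?_)
  intro ε hε
  have hpos := hl.add_smul hw hε
  obtain ⟨V, hV, hVf, hVm⟩ := exists_val_stratumPoint hτ hpos.mem_cone (hwl ε hε)
  have hlt : ∀ m : Γ, m ≠ 0 → 0 < restrict Γ (stratumPoint hτ (w + ε • l)) m := by
    intro m hm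
    by_cases hmp : (m : M) ∈ perp Γ τ
    · rw [restrict_stratumPoint_of_mem hτ _ hmp, ← WithTop.coe_zero, WithTop.coe_lt_coe]
      exact hpos m hmp fun h => hm (Subtype.ext h)
    · rw [restrict_stratumPoint_of_notMem hτ _ hmp]
      exact WithTop.coe_lt_top 0
  exact ⟨mem_extConeInterior_of_restrict hlt,
    mem_image_localVals hV hVf hVm fun m hm => by rw [← hVm]; exact hlt m hm⟩

/-- Under `t ↦ e^{-t}` the nonnegative valuations infinite on `f` become a closed subset of a
product of intervals `[0, 1]`, compact by Tychonoff. Restriction to monomials has compact, hence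
closed, image, whose preimage in `L` is the tropicalization. -/
theorem isClosed_nnTropSeries (f : Series Γ K) : IsClosed (nnTropSeries f) := by
  let Z : Set (Series Γ K → ℝ) := {a | IsMulSeminorm a ∧ (∀ g, a g ≤ 1) ∧ a f = 0}
  have hZclosed : IsClosed Z := by
    have h1 : Z = {a | ∀ g, 0 ≤ a g} ∩ {a | a 0 = 0} ∩ {a | a 1 = 1} ∩
        {a | ∀ g h, a (g + h) ≤ max (a g) (a h)} ∩ {a | ∀ g h, a (g * h) = a g * a h} ∩
        {a | ∀ g, a g ≤ 1} ∩ {a | a f = 0} := by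
      ext a
      exact ⟨fun ⟨h, h1, h2⟩ => ⟨⟨⟨⟨⟨⟨h.nonneg, h.zero⟩, h.one⟩, h.add⟩, h.mul⟩, h1⟩, h2⟩,
        fun ⟨⟨⟨⟨⟨⟨h1, h2⟩, h3⟩, h4⟩, h5⟩, h6⟩, h7⟩ => ⟨⟨h1, h2, h3, h4, h5⟩, h6, h7⟩⟩
    rw [h1]
    have hev : ∀ g, Continuous fun a : Series Γ K → ℝ => a g := fun g => continuous_apply g
    simp only [Set.ofPred_forall]
    refine ((((((isClosed_iInter fun g => isClosed_le continuous_const (hev g)).inter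
      (isClosed_eq (hev _) continuous_const)).inter
      (isClosed_eq (hev _) continuous_const)).inter
      (isClosed_iInter fun g => isClosed_iInter fun h =>
        isClosed_le (hev _) ((hev _).max (hev _)))).inter
      (isClosed_iInter fun g => isClosed_iInter fun h =>
        isClosed_eq (hev _) ((hev _).mul (hev _)))).inter
      (isClosed_iInter fun g => isClosed_le (hev g) continuous_const)).inter
      (isClosed_eq (hev _) continuous_const)
  have hZ : IsCompact Z :=
    IsCompact.of_isClosed_subset
      (isCompact_univ_pi fun _ : Series Γ K => isCompact_Icc (a := (0 : ℝ)) (b := 1)) hZclosed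
      fun a ha g _ => ⟨ha.1.nonneg g, ha.2.1 g⟩
  let res : (Series Γ K → ℝ) → (Γ → ℝ) := fun a m => a (monomial K m)
  have hres : Continuous res := continuous_pi fun m => continuous_apply _
  let ψ : LinVar Γ → (Γ → ℝ) := fun x m => expNeg (restrict Γ x m)
  have hψ : Continuous ψ := continuous_pi fun m => continuous_expNeg.comp
    ((continuous_apply (AddSubmonoid.inclusion (le_sat Γ) m)).comp continuous_induced_dom)
  have heq : nnTropSeries f = ψ ⁻¹' (res '' Z) := by
    ext x
    rw [mem_nnTropSeries_iff]
    constructor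
    · rintro ⟨V, hV, hf, hx⟩
      refine ⟨fun g => expNeg (V g), ⟨isMulSeminorm_expNeg V, fun g => ?_, ?_⟩, ?_⟩
      · rw [← expNeg_zero]
        exact expNeg_strictAnti.antitone (hV g)
      · show expNeg (V f) = 0
        rw [hf, expNeg_top]
      · funext m
        exact congrArg expNeg (hx m).symm
    · rintro ⟨a, ⟨ha, ha1, haf⟩, hax⟩
      obtain ⟨V, hV⟩ := ha.exists_val
      have hinj := expNeg_strictAnti.injective
      refine ⟨V, fun g => ?_, ?_, fun m => ?_⟩
      · rw [← expNeg_strictAnti.le_iff_ge, hV, expNeg_zero]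
        exact ha1 g
      · apply hinj; rw [hV, haf, expNeg_top]
      · apply hinj
        rw [hV]
        exact (congrFun hax m).symm
  rw [heq]
  exact (hZ.image hres).isClosed.preimage hψ

theorem closureIn_posTropSeries [Module.Free ℤ M] [Module.Finite ℤ M] (f : Series Γ K) :
    closureIn (extCone Γ) (posTropSeries f) = nnTropSeries f := by
  refine Set.Subset.antisymm ?_ fun x hx => ?_
  · refine closureIn_subset.trans (closure_minimal ?_ (isClosed_nnTropSeries f))
    refine closureIn_subset.trans (closure_minimal ?_ (isClosed_nnTropSeries f))
    exact Set.image_mono fun v hv => hv.1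
  · have hext : x ∈ extCone Γ := by
      obtain ⟨V, hV, -, hx⟩ := mem_nnTropSeries_iff.1 hx
      exact mem_extCone_of_restrict fun m => by rw [hx]; exact hV _
    refine mem_closureIn hext ?_
    rw [nnTropSeries_eq] at hx
    obtain ⟨τ, hτ, w, hw, rfl⟩ := Set.mem_iUnion₂.1 hx
    refine closure_mono ?_ (stratumPoint_mem_closure hτ hw)
    exact fun y hy => ⟨hy.1.1, mem_closureIn hy.1 (subset_closure hy)⟩

end Tropicalizations

end

end LocalTrop

theorem propositionP {M : Type*} [AddCommGroup M] [Module.Free ℤ M] [Module.Finite ℤ M]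
    (Γ : AddSubmonoid M) [LocalTrop.PointedAffine Γ]
    (hΓ : AddSubgroup.closure (Γ : Set M) = ⊤)
    {K : Type*} [Field K] (f : LocalTrop.Series Γ K) (hf : ¬ IsUnit f) :
    LocalTrop.nnTropSeries f = LocalTrop.extendedNewtonCone f ∧
    LocalTrop.closureIn (LocalTrop.extCone Γ) (LocalTrop.posTropSeries f) =
      LocalTrop.nnTropSeries f :=
  ⟨LocalTrop.nnTropSeries_eq f, LocalTrop.closureIn_posTropSeries f⟩
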